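/- **Setting.** An *enhanced level graph* $\Gamma$ is a finite connected stable graph (loops and multiple edges allowed) with vertices $v$ of genus $g_v\ge 0$, edges $E$ and legs $H$, together with integers $\mu_h$ for $h\in H$, a level function $\ell$ from the vertices to $L(\Gamma)=\{0,-1,\dots,-N\}$, and integers $\kappa_e\ge 0$ for $e\in E$ with $\kappa_e=0$ if and only if $e$ is horizontal, i.e. joins vertices of the same level. The ends of $e$ are denoted $v(e+),v(e-)$ with $\ell(v(e+))\ge \ell(v(e-))$, with an arbitrary choice for horizontal edges. At every vertex the degree condition $$\sum_{h\text{ at }v}\mu_h+\sum_{e:\,v(e+)=v}(\kappa_e-1)+\sum_{e:\,v(e-)=v}(-\kappa_e-1)=2g_v-2$$ holds. Let $\Sigma$ be a compact connected Riemann surface with distinct marked points indexed by $H$; let $Z$ be the set of marked zeros ($\mu_h\ge 0$) and $P$ the set of marked poles ($\mu_h<0$). Let $\{\lambda_e\}_{e\in E}$ be disjoint simple closed curves in $\Sigma\setminus(Z\cup P)$, with disjoint annular neighbourhoods, such that pinching all of them yields topologically a pointed stable curve with dual graph $\Gamma$. For $i\in\mathbb Z$ let $\Sigma_{(\le i)}\subseteq\Sigma$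 be the subsurface of levels at most $i$, obtained by removing the open annuli around those $\lambda_e$ with $\ell(v(e+))>i\ge \ell(v(e-))$ and keeping the part of level at most $i$. All homology is singular homology with coefficients in $\mathbb C$, $H_1(B,A)$ means $H_1(B,A\cap B)$, and $\langle\cdot,\lambda_e\rangle$ is the algebraic intersection number with $\lambda_e$. Let $E^{hor}_{(i)}$ be the set of horizontal edges of level $i$ and $E^{hor}$ the set of all horizontal edges. Define the level filtration and the vertical filtration by $$W_i=\operatorname{im}\bigl(H_1(\Sigma_{(\le i)}\setminus P,Z)\to H_1(\Sigma\setminus P,Z)\bigr),\qquad U_i=\{c\in W_i:\ \langle c,\lambda_e\rangle=0\ \text{ for all } e\in E^{hor}_{(i)}\}.$$ A class $c$ has top level $i$ if $c\in W_i\setminus W_{i-1}$. It is *horizontal-crossing* if $\langle c,\lambda_e\rangle\ne0$ for some horizontal $e$ whose level is the top level of $c$, and *non-horizontal* otherwise. **Proposition 4.3.** For every enhanced level graph $\Gamma$ and every such $(\Sigma,Z,P,\{\lambda_e\})$, the space $H_1(\Sigma\setminus P,Z)$ has a (finite) $\Gamma$-adapted basis, i.e. a basis that is a disjoint union $$\bigsqcup_{i\in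 L(\Gamma)}\Bigl(\{\alpha^{(i)}_1,\dots,\alpha^{(i)}_{n(i)}\}\sqcup\{\delta^{(i)}_e:\ e\in E^{hor}_{(i)}\}\Bigr)$$ of horizontal-crossing cycles $\delta^{(i)}_e\in W_i\setminus U_i$ and non-horizontal cycles $\alpha^{(i)}_k\in U_i\setminus W_{i-1}$ such that for every $i\in L(\Gamma)$: 1. $W_i$ is spanned by all $\alpha^{(j)}_k$ and $\delta^{(j)}_e$ with $j\le i$; 2. the natural projection maps $\langle \delta^{(i)}_e: e\in E^{hor}_{(i)}\rangle_{\mathbb C}$ isomorphically onto $W_i/U_i$; 3. the natural projection maps $\langle \alpha^{(i)}_1,\dots,\alpha^{(i)}_{n(i)}\rangle_{\mathbb C}$ isomorphically onto $U_i/W_{i-1}$; 4. for $e\in E^{hor}_{(i)}$ and $e'\in E^{hor}$, $\langle\delta^{(i)}_e,\lambda_{e'}\rangle$ is $1$ if $e'=e$ and $0$ otherwise. -/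

import Mathlib

open Set

/-! ### Relative singular homology in degree one, with complex coefficients -/

namespace SingH

/-- The quotient `Z / B` of two submodules `B ≤ Z` of a complex vector space. -/
abbrev SubQuot {M : Type*} [AddCommGroup M] [Module ℂ M] (Z B : Submodule ℂ M) : Type _ :=
  Z ⧸ B.submoduleOf Z

/-- The map `Z / B → Z' / B'` induced by inclusions `Z ≤ Z'` and `B ≤ B'`. -/
def SubQuot.incl {M : Type*} [AddCommGroup M] [Module ℂ M] {Z B Z' B' : Submodule ℂ M}
    (hZ : Z ≤ Z') (hB : B ≤ B') : SubQuot Z B →ₗ[ℂ] SubQuot Z' B' :=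
  Submodule.mapQ _ _ (Submodule.inclusion hZ) (fun _ hx => hB hx)

/-- The functional on `Z / B` induced by a functional that vanishes on `B`. -/
def SubQuot.lift {M : Type*} [AddCommGroup M] [Module ℂ M] {Z B : Submodule ℂ M} (f : M →ₗ[ℂ] ℂ)
    (hB : ∀ x ∈ B, f x = 0) : SubQuot Z B →ₗ[ℂ] ℂ :=
  Submodule.liftQ _ (f.comp Z.subtype) (fun _ hx => hB _ hx)

/-- A singular `n`-simplex of `X`. -/
abbrev Simplex (n : ℕ) (X : Type*) [TopologicalSpace X] : Type _ :=
  C(stdSimplex ℝ (Fin (n + 1)), X)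

/-- Singular `n`-chains of `X` with coefficients in `ℂ`. -/
abbrev Chain (n : ℕ) (X : Type*) [TopologicalSpace X] : Type _ := Simplex n X →₀ ℂ

section

variable {X : Type*} [TopologicalSpace X]

/-- The `i`-th face of a singular simplex. -/
noncomputable def face {n : ℕ} (i : Fin (n + 2)) (σ : Simplex (n + 1) X) : Simplex n X :=
  σ.comp ⟨stdSimplex.map (Fin.succAbove i), stdSimplex.continuous_map _⟩

/-- The singular boundary operator, `∂σ = ∑ i, (-1) ^ i • (i-th face of σ)`. -/
noncomputable def boundary (n : ℕ) : Chain (n + 1) X →ₗ[ℂ] Chain n X :=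
  Finsupp.linearCombination ℂ
    (fun σ : Simplex (n + 1) X => ∑ i : Fin (n + 2), Finsupp.single (face i σ) ((-1 : ℂ) ^ (i : ℕ)))

/-- The chains supported in a subset `Y` of `X`, i.e. the singular chains of the subspace `Y`. -/
noncomputable def chainsIn (n : ℕ) (Y : Set X) : Submodule ℂ (Chain n X) :=
  Finsupp.supported ℂ ℂ {σ : Simplex n X | range σ ⊆ Y}

/-- Relative one-cycles of the pair `(Y, A ∩ Y)`. -/
noncomputable def relCycles (Y A : Set X) : Submodule ℂ (Chain 1 X) :=
  chainsIn 1 Y ⊓ (chainsIn 0 (A ∩ Y)).comap (boundary 0)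

/-- Relative one-boundaries of the pair `(Y, A ∩ Y)`. -/
noncomputable def relBoundaries (Y A : Set X) : Submodule ℂ (Chain 1 X) :=
  (chainsIn 2 Y).map (boundary 1) ⊔ chainsIn 1 (A ∩ Y)

/-- The relative singular homology group `H₁(Y, A; ℂ)` of two subsets `Y`, `A` of `X`, with the
convention that `H₁(Y, A)` stands for `H₁(Y, A ∩ Y)`. -/
abbrev H1 (Y A : Set X) : Type _ :=
  SubQuot (relCycles Y A) (relBoundaries Y A)

theorem chainsIn_mono (n : ℕ) {Y Y' : Set X} (h : Y ⊆ Y') : chainsIn n Y ≤ chainsIn n Y' :=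
  Finsupp.supported_mono fun _ hσ => Subset.trans hσ h

theorem relCycles_mono {Y Y' : Set X} (A : Set X) (h : Y ⊆ Y') :
    relCycles Y A ≤ relCycles Y' A :=
  inf_le_inf (chainsIn_mono 1 h)
    (Submodule.comap_mono (chainsIn_mono 0 (inter_subset_inter_right A h)))

theorem relBoundaries_mono {Y Y' : Set X} (A : Set X) (h : Y ⊆ Y') :
    relBoundaries Y A ≤ relBoundaries Y' A :=
  sup_le_sup (Submodule.map_mono (chainsIn_mono 2 h))
    (chainsIn_mono 1 (inter_subset_inter_right A h))

/-- The map `H₁(Y, A) → H₁(Y', A)` induced by an inclusion `Y ⊆ Y'`. -/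
noncomputable def inclMap {Y Y' : Set X} (A : Set X) (h : Y ⊆ Y') : H1 Y A →ₗ[ℂ] H1 Y' A :=
  SubQuot.incl (relCycles_mono A h) (relBoundaries_mono A h)

/-! ### The winding homomorphism of a map to the circle `ℝ / ℤ` -/

theorem exists_lift {n : ℕ} (g : C(stdSimplex ℝ (Fin (n + 1)), AddCircle (1 : ℝ))) :
    ∃ f : C(stdSimplex ℝ (Fin (n + 1)), ℝ), ∀ x, ((f x : ℝ) : AddCircle (1 : ℝ)) = g x := by
  have hc : Convex ℝ (stdSimplex ℝ (Fin (n + 1))) := convex_stdSimplex ℝ _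
  have : LocallyPathConnectedSpace (stdSimplex ℝ (Fin (n + 1))) := hc.locallyPathConnectedSpace
  have : ContractibleSpace (stdSimplex ℝ (Fin (n + 1))) :=
    hc.contractibleSpace ⟨_, single_mem_stdSimplex ℝ 0⟩
  let a₀ : stdSimplex ℝ (Fin (n + 1)) := stdSimplex.vertex 0
  obtain ⟨e₀, he⟩ := QuotientAddGroup.mk_surjective (g a₀)
  obtain ⟨f, ⟨-, hf⟩, -⟩ :=
    (AddCircle.isCoveringMap_coe (1 : ℝ)).existsUnique_continuousMap_lifts g a₀ e₀ he
  exact ⟨f, fun x => congrFun hf x⟩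

theorem lift_sub_eq {n : ℕ} (f f' : C(stdSimplex ℝ (Fin (n + 1)), ℝ))
    (h : ∀ x, ((f x : ℝ) : AddCircle (1 : ℝ)) = ((f' x : ℝ) : AddCircle (1 : ℝ)))
    (x y : stdSimplex ℝ (Fin (n + 1))) : f x - f y = f' x - f' y := by
  have key := (AddCircle.isCoveringMap_coe (1 : ℝ)).eq_of_comp_eq (A := stdSimplex ℝ (Fin (n + 1)))
    (g₁ := fun z => f z) (g₂ := fun z => f' z + (f y - f' y)) (by fun_prop) (by fun_prop)
    (by
      funext z
      have h1 := h z
      have h2 := h y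
      simp only [Function.comp_apply, AddCircle.coe_add, AddCircle.coe_sub, h1, h2, sub_self,
        add_zero]) y (by ring)
  have := congrFun key x
  linarith

/-- For a path `σ` and a map `g` to the circle `ℝ / ℤ`: the total increment along `σ` of a
continuous real lift of `g ∘ σ`. -/
noncomputable def increment (g : C(X, AddCircle (1 : ℝ))) (σ : Simplex 1 X) : ℝ :=
  (exists_lift (g.comp σ)).choose (stdSimplex.vertex 1) -
    (exists_lift (g.comp σ)).choose (stdSimplex.vertex 0)

theorem increment_eq (g : C(X, AddCircle (1 : ℝ))) (σ : Simplex 1 X)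
    (f : C(stdSimplex ℝ (Fin 2), ℝ)) (hf : ∀ x, ((f x : ℝ) : AddCircle (1 : ℝ)) = g (σ x)) :
    increment g σ = f (stdSimplex.vertex 1) - f (stdSimplex.vertex 0) :=
  lift_sub_eq _ f
    (fun x => ((exists_lift (g.comp σ)).choose_spec x).trans (hf x).symm) _ _

/-- The linear extension of `increment g` to singular one-chains. -/
noncomputable def chainWinding (g : C(X, AddCircle (1 : ℝ))) : Chain 1 X →ₗ[ℂ] ℂ :=
  Finsupp.linearCombination ℂ (fun σ : Simplex 1 X => (increment g σ : ℂ))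

theorem chainWinding_boundary (g : C(X, AddCircle (1 : ℝ))) (c : Chain 2 X) :
    chainWinding g (boundary 1 c) = 0 := by
  have h : (chainWinding g).comp (boundary 1) = 0 := by
    refine Finsupp.lhom_ext' fun σ => LinearMap.ext_ring ?_
    obtain ⟨f, hf⟩ := exists_lift (g.comp σ)
    have hface : ∀ i : Fin 3, increment g (face i σ) =
        f (stdSimplex.vertex (i.succAbove 1)) - f (stdSimplex.vertex (i.succAbove 0)) := by
      intro i
      have := increment_eq g (face i σ)
        (f.comp ⟨stdSimplex.map (Fin.succAbove i), stdSimplex.continuous_map _⟩)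
        (fun x => hf _)
      simpa [stdSimplex.map_vertex] using this
    simp only [LinearMap.comp_apply, Finsupp.lsingle_apply, boundary, chainWinding,
      Finsupp.linearCombination_single, one_smul, map_sum, LinearMap.zero_apply, smul_eq_mul,
      hface]
    refine (Fin.sum_univ_three _).trans ?_
    have e0 : (0 : Fin 3).succAbove (0 : Fin 2) = 1 := rfl
    have e1 : (0 : Fin 3).succAbove (1 : Fin 2) = 2 := rfl
    have e2 : (1 : Fin 3).succAbove (0 : Fin 2) = 0 := rfl
    have e3 : (1 : Fin 3).succAbove (1 : Fin 2) = 2 := rfl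
    have e4 : (2 : Fin 3).succAbove (0 : Fin 2) = 0 := rfl
    have e5 : (2 : Fin 3).succAbove (1 : Fin 2) = 1 := rfl
    rw [e0, e1, e2, e3, e4, e5]
    push_cast
    simp
  exact LinearMap.congr_fun h c

theorem chainWinding_eq_zero (g : C(X, AddCircle (1 : ℝ))) {A : Set X} (hg : ∀ a ∈ A, g a = 0)
    {c : Chain 1 X} (hc : c ∈ chainsIn 1 A) : chainWinding g c = 0 := by
  rw [chainWinding, Finsupp.linearCombination_apply]
  refine Finset.sum_eq_zero fun σ hσ => ?_
  have hσA : range σ ⊆ A := hc hσ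
  have := increment_eq g σ 0 (fun x => by simp [hg _ (hσA (mem_range_self x))])
  simp [this]

/-- The homomorphism `H₁(Y, A) → ℂ` induced by a map `g` to the circle `ℝ / ℤ` that sends `A` to the
base point: the degree of `g` along a relative cycle. -/
noncomputable def winding (g : C(X, AddCircle (1 : ℝ))) (Y A : Set X) (hg : ∀ a ∈ A, g a = 0) :
    H1 Y A →ₗ[ℂ] ℂ :=
  SubQuot.lift (chainWinding g) (by
    intro c hc
    obtain ⟨_, ⟨b, -, rfl⟩, a, ha, rfl⟩ := Submodule.mem_sup.1 hc
    rw [map_add, chainWinding_boundary, zero_add]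
    exact chainWinding_eq_zero g hg (chainsIn_mono 1 inter_subset_left ha))

end

end SingH

/-! ### Enhanced level graphs -/

open scoped Classical in
/-- An enhanced level graph: a connected stable graph with vertices `V`, edges `E` and half-edges
(legs) `H`, where loops and multiple edges are allowed, together with the zero/pole orders at the
legs, a level function and an enhancement. An edge `e` joins `top e` (its `+` end) to
`bot e` (its `-` end), and `top e` is not below `bot e`. -/
structure EnhancedLevelGraph (V E H : Type*) [Fintype V] [Fintype E] [Fintype H] where
  genus : V → ℕ
  top : E → V
  bot : E → V
  vert : H → V
  /-- the prescribed orders `μ` of the differential at the marked points -/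
  order : H → ℤ
  /-- the levels are `0, -1, …, -depth` -/
  depth : ℕ
  level : V → ℤ
  /-- the number of prongs `κ` -/
  prongs : E → ℕ
  nonempty : Nonempty V
  connected : ∀ v w : V, Relation.EqvGen (fun a b => ∃ e, top e = a ∧ bot e = b) v w
  level_mem : ∀ v, level v ∈ Icc (-(depth : ℤ)) 0
  level_bot_le : ∀ e, level (bot e) ≤ level (top e)
  prongs_eq_zero_iff : ∀ e, prongs e = 0 ↔ level (bot e) = level (top e)
  /-- stability, `2 g(v) - 2 + n(v) > 0` -/
  stable : ∀ v, 2 < 2 * genus v + (Finset.univ.filter fun h => vert h = v).card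
    + (Finset.univ.filter fun e => top e = v).card + (Finset.univ.filter fun e => bot e = v).card
  /-- The orders `μ` at the legs, `κ - 1` at the upper and `-κ - 1` at the lower ends of the edges
  are the orders of a meromorphic differential on a surface of genus `g(v)`. -/
  degree : ∀ v, (∑ h with vert h = v, order h) + (∑ e with top e = v, ((prongs e : ℤ) - 1))
    + (∑ e with bot e = v, (-(prongs e : ℤ) - 1)) = 2 * (genus v : ℤ) - 2

namespace EnhancedLevelGraph

variable {V E H : Type*} [Fintype V] [Fintype E] [Fintype H] (Γ : EnhancedLevelGraph V E H)

open scoped Classical in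
/-- The number of half-edges at `v`: legs and ends of edges. -/
noncomputable def valence (v : V) : ℕ :=
  (Finset.univ.filter fun h => Γ.vert h = v).card
    + (Finset.univ.filter fun e => Γ.top e = v).card
    + (Finset.univ.filter fun e => Γ.bot e = v).card

/-- The set of levels `{0, -1, …, -depth}`. -/
abbrev Levels : Type := Icc (-(Γ.depth : ℤ)) 0

/-- An edge is horizontal if it joins vertices of the same level. -/
def IsHorizontal (e : E) : Prop := Γ.level (Γ.bot e) = Γ.level (Γ.top e)

/-- The horizontal edges of level `i`. -/
abbrev HorEdge (i : ℤ) : Type _ := {e : E // Γ.IsHorizontal e ∧ Γ.level (Γ.top e) = i}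

end EnhancedLevelGraph

/-! ### Surfaces degenerating to a stable curve with a given enhanced level graph -/

/-- The multicurve on the marked closed surface `S` whose pinching yields, topologically, a pointed
stable curve with dual graph `Γ`. The vanishing cycle of `e` is given together with an annular
neighbourhood: it is the core `collar e '' {t = 1/2}`. The pieces are the connected components of
the complement of the vanishing cycles, i.e. the irreducible components of the stable curve without
the nodes. -/
structure PinchedSurface {V E H : Type*} [Fintype V] [Fintype E] [Fintype H]
    (Γ : EnhancedLevelGraph V E H) (S : Type*) [TopologicalSpace S] where
  mark : H → S
  collar : E → Circle × unitInterval → S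
  piece : V → Set S
  mark_injective : Function.Injective mark
  isEmbedding_collar : ∀ e, Topology.IsEmbedding (collar e)
  isOpen_collar : ∀ e, IsOpen (collar e '' {p | 0 < (p.2 : ℝ) ∧ (p.2 : ℝ) < 1})
  disjoint_collar : ∀ e e', e ≠ e' → Disjoint (range (collar e)) (range (collar e'))
  mark_notMem_collar : ∀ h e, mark h ∉ range (collar e)
  isOpen_piece : ∀ v, IsOpen (piece v)
  isConnected_piece : ∀ v, IsConnected (piece v)
  disjoint_piece : ∀ v w, v ≠ w → Disjoint (piece v) (piece w)
  iUnion_piece : ⋃ v, piece v = (⋃ e, collar e '' {p | (p.2 : ℝ) = 1 / 2})ᶜ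
  collar_mem_bot : ∀ e p, (p.2 : ℝ) < 1 / 2 → collar e p ∈ piece (Γ.bot e)
  collar_mem_top : ∀ e p, 1 / 2 < (p.2 : ℝ) → collar e p ∈ piece (Γ.top e)
  mark_mem : ∀ h, mark h ∈ piece (Γ.vert h)
  /-- The piece of `v` has genus `g(v)`. Punctured at its marked points it is a connected surface
  with `n = Γ.valence v` punctures, and its genus `g` is given by the first Betti number
  `2 g + n - 1`, where `n` is positive by stability and the degree condition of `Γ`. -/
  genus_piece : ∀ v, Module.finrank ℂ (SingH.H1 (piece v \ range mark) ∅) + 1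
    = 2 * Γ.genus v + Γ.valence v

namespace PinchedSurface

variable {V E H : Type*} [Fintype V] [Fintype E] [Fintype H] {Γ : EnhancedLevelGraph V E H}
  {S : Type*} [TopologicalSpace S] (D : PinchedSurface Γ S)

/-- The marked zeros. -/
def zeros : Set S := D.mark '' {h | 0 ≤ Γ.order h}

/-- The marked poles. -/
def poles : Set S := D.mark '' {h | Γ.order h < 0}

/-- The vanishing cycle `λ_e`. -/
def vanishingCycle (e : E) : Set S := D.collar e '' {p | (p.2 : ℝ) = 1 / 2}

/-- The open annular neighbourhood `λ_e°` of the vanishing cycle. -/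
def openAnnulus (e : E) : Set S := D.collar e '' {p | 0 < (p.2 : ℝ) ∧ (p.2 : ℝ) < 1}

/-- The subsurface `Σ_{≤ i}`: the open annuli around the vertical vanishing cycles that join levels
above `i` to levels at most `i` are removed from `S`, and the part of level at most `i` is kept. -/
def surfaceLE (i : ℤ) : Set S :=
  ((⋃ v ∈ {v | Γ.level v ≤ i}, D.piece v) ∪
    ⋃ e ∈ {e | Γ.level (Γ.top e) ≤ i}, D.vanishingCycle e) \
  ⋃ e ∈ {e | Γ.level (Γ.bot e) ≤ i ∧ i < Γ.level (Γ.top e)}, D.openAnnulus e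

/-- The relative homology `H₁(S ∖ P, Z; ℂ)`. -/
abbrev RelH1 : Type _ := SingH.H1 D.polesᶜ D.zeros

/-- The level filtration: `W i` is the image of `H₁(Σ_{≤ i} ∖ P, Z)` in `H₁(S ∖ P, Z)`. -/
noncomputable def W (i : ℤ) : Submodule ℂ D.RelH1 :=
  LinearMap.range (SingH.inclMap (Y := D.surfaceLE i \ D.poles) (Y' := D.polesᶜ) D.zeros
    (fun _ hx => hx.2))

open scoped Classical in
/-- The map that collapses the complement of the annulus around `λ_e` to the base point of the
circle `ℝ / ℤ`, and is the transverse coordinate on the annulus. -/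
noncomputable def collapseFun (e : E) (x : S) : AddCircle (1 : ℝ) :=
  if h : ∃ p, D.collar e p = x then ((h.choose.2 : ℝ) : AddCircle (1 : ℝ)) else 0

theorem collapseFun_collar (e : E) (p : Circle × unitInterval) :
    D.collapseFun e (D.collar e p) = ((p.2 : ℝ) : AddCircle (1 : ℝ)) := by
  have h : ∃ q, D.collar e q = D.collar e p := ⟨p, rfl⟩
  rw [collapseFun, dif_pos h, (D.isEmbedding_collar e).injective h.choose_spec]

theorem collapseFun_of_notMem (e : E) {x : S} (hx : x ∉ D.openAnnulus e) :
    D.collapseFun e x = 0 := by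
  by_cases h : ∃ p, D.collar e p = x
  · obtain ⟨p, rfl⟩ := h
    rw [collapseFun_collar]
    have h0 : (0 : ℝ) ≤ p.2 := p.2.2.1
    have h1 : (p.2 : ℝ) ≤ 1 := p.2.2.2
    rcases h0.eq_or_lt with h0 | h0
    · simp [← h0]
    rcases h1.eq_or_lt with h1 | h1
    · rw [h1]
      exact AddCircle.coe_period 1
    · exact absurd ⟨p, ⟨h0, h1⟩, rfl⟩ hx
  · rw [collapseFun, dif_neg h]

theorem continuous_collapseFun [T2Space S] (e : E) : Continuous (D.collapseFun e) := by
  have hcl : IsClosed (range (D.collar e)) :=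
    (isCompact_range (D.isEmbedding_collar e).continuous).isClosed
  have h1 : ContinuousOn (D.collapseFun e) (range (D.collar e)) := by
    rw [continuousOn_iff_continuous_domRestrict]
    have hf : Continuous fun p : Circle × unitInterval =>
        D.collapseFun e (D.collar e p) := by
      simp only [collapseFun_collar]
      exact (AddCircle.continuous_mk' (1 : ℝ)).comp (by fun_prop)
    have : (range (D.collar e)).domRestrict (D.collapseFun e) =
        (fun p => D.collapseFun e (D.collar e p)) ∘
          (D.isEmbedding_collar e).toHomeomorph.symm := by
      funext x
      obtain ⟨p, rfl⟩ := (D.isEmbedding_collar e).toHomeomorph.surjective x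
      rw [Function.comp_apply, Homeomorph.symm_apply_apply]
      rfl
    rw [this]
    exact hf.comp (Homeomorph.continuous _)
  have h2 : ContinuousOn (D.collapseFun e) (D.openAnnulus e)ᶜ :=
    continuousOn_const.congr fun x hx => D.collapseFun_of_notMem e hx
  have h3 : range (D.collar e) ∪ (D.openAnnulus e)ᶜ = univ := by
    refine eq_univ_of_forall fun x => ?_
    by_cases hx : x ∈ D.openAnnulus e
    · obtain ⟨p, -, rfl⟩ := hx
      exact Or.inl (mem_range_self p)
    · exact Or.inr hx
  rw [← continuousOn_univ, ← h3]
  exact h1.union_of_isClosed h2 hcl (D.isOpen_collar e).isClosed_compl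

theorem collapseFun_zeros (e : E) : ∀ x ∈ D.zeros, D.collapseFun e x = 0 := by
  rintro _ ⟨h, -, rfl⟩
  refine D.collapseFun_of_notMem e ?_
  rintro ⟨p, -, hp⟩
  exact D.mark_notMem_collar h e ⟨p, hp⟩

/-- The algebraic intersection number `⟨γ, λ_e⟩` of `γ ∈ H₁(S ∖ P, Z)` with the vanishing cycle
`λ_e`. It is the signed number of times that `γ` crosses `λ_e`, counted as the degree along `γ` of
the collapse of the annulus around `λ_e`, a map that represents the Poincaré dual of `λ_e`. The cycle
`λ_e` is oriented so that crossing it from its `bot` side to its `top` side counts `+1`. -/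
noncomputable def inter [T2Space S] (e : E) : D.RelH1 →ₗ[ℂ] ℂ :=
  SingH.winding ⟨D.collapseFun e, D.continuous_collapseFun e⟩ D.polesᶜ D.zeros
    (D.collapseFun_zeros e)

/-- The vertical filtration: `U i` consists of the classes in `W i` that are orthogonal to all
horizontal vanishing cycles of level `i`. -/
noncomputable def U [T2Space S] (i : ℤ) : Submodule ℂ D.RelH1 :=
  D.W i ⊓ ⨅ e : Γ.HorEdge i, LinearMap.ker (D.inter e.1)

/-- `c` has top level `i`. -/
def HasTopLevel (c : D.RelH1) (i : ℤ) : Prop := c ∈ D.W i ∧ c ∉ D.W (i - 1)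

/-- A horizontal-crossing cycle: it crosses some horizontal node at its top level. -/
def IsHorizontalCrossing [T2Space S] (c : D.RelH1) : Prop :=
  ∃ i, D.HasTopLevel c i ∧ ∃ e : Γ.HorEdge i, D.inter e.1 c ≠ 0

/-- The natural projection `M → M ⧸ B` restricts to an isomorphism of `T` onto `A / B`. -/
def MapsIsoOnto {M : Type*} [AddCommGroup M] [Module ℂ M] (T A B : Submodule ℂ M) : Prop :=
  Function.Injective (B.mkQ.domRestrict T) ∧ LinearMap.range (B.mkQ.domRestrict T) = A.map B.mkQ

/-- A `Γ`-adapted basis of `H₁(S ∖ P, Z; ℂ)`. The partition of the basis is encoded in its index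
type: `b ⟨i, inl k⟩` is the cycle `α_k` of level `i`, for `k < n i`, and `b ⟨i, inr e⟩` is the cycle
`δ_e` of the horizontal edge `e` of level `i`. -/
structure IsAdapted [T2Space S] {n : Γ.Levels → ℕ}
    (b : Module.Basis (Σ i : Γ.Levels, Fin (n i) ⊕ Γ.HorEdge i) ℂ D.RelH1) : Prop where
  crossing_mem : ∀ (i : Γ.Levels) (e : Γ.HorEdge i), b ⟨i, Sum.inr e⟩ ∈ D.W i ∧ b ⟨i, Sum.inr e⟩ ∉ D.U i
  isHorizontalCrossing : ∀ (i : Γ.Levels) (e : Γ.HorEdge i),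
    D.IsHorizontalCrossing (b ⟨i, Sum.inr e⟩)
  nonhorizontal_mem : ∀ (i : Γ.Levels) (k : Fin (n i)),
    b ⟨i, Sum.inl k⟩ ∈ D.U i ∧ b ⟨i, Sum.inl k⟩ ∉ D.W (i - 1)
  not_isHorizontalCrossing : ∀ (i : Γ.Levels) (k : Fin (n i)),
    ¬ D.IsHorizontalCrossing (b ⟨i, Sum.inl k⟩)
  level_eq_span : ∀ i : Γ.Levels, D.W i = Submodule.span ℂ (b '' {x | x.1 ≤ i})
  graded_crossing : ∀ i : Γ.Levels,
    MapsIsoOnto (Submodule.span ℂ (range fun e => b ⟨i, Sum.inr e⟩)) (D.W i) (D.U i)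
  graded_nonhorizontal : ∀ i : Γ.Levels,
    MapsIsoOnto (Submodule.span ℂ (range fun k => b ⟨i, Sum.inl k⟩)) (D.U i) (D.W (i - 1))
  inter_self : ∀ (i : Γ.Levels) (e : Γ.HorEdge i), D.inter e.1 (b ⟨i, Sum.inr e⟩) = 1
  inter_of_ne : ∀ (i : Γ.Levels) (e : Γ.HorEdge i) (e' : E), Γ.IsHorizontal e' → e' ≠ e.1 →
    D.inter e' (b ⟨i, Sum.inr e⟩) = 0

end PinchedSurface

/-! The heart of the matter is a system of cycles dual to the horizontal vanishing cycles. If a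
vertex carries no marked zero and no edge to a lower level, every half-edge at it contributes at
most `-1` to the degree condition, so `2g - 2 ≤ -n`, against stability
(`exists_zero_or_descending_edge`). Hence from either side of a horizontal node of level `i` one can
descend, through vertical nodes only, to a marked zero (`exists_joinedIn_zero`). A path up from a
zero, across `λ_e` once, and down to a zero again is a relative cycle in `W i` that meets `λ_e` once
and no other horizontal vanishing cycle (`exists_crossing_cycle`). Its intersection numbers are
degrees of the collapse maps: a path that avoids `λ_e` and starts and ends over the base point has
increment zero, because its real lift cannot pass a half-integer (`increment_eq_zero_of_ne_half`).

The rest is linear algebra. Classes of `W (i - 1)` are represented away from the annuli of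
horizontal edges of level `i`, so `W (i - 1) ≤ U i ≤ W i`. By duality the `δ_e` of level `i` are a
basis of a complement of `U i` in `W i`; the `α_k` are a basis of any complement of `W (i - 1)` in
`U i`. Since `W` grows from `⊥` to `⊤`, induction on the level shows that all of them together form
a basis (`exists_graded_basis`).

The index type also demands that `H₁(S ∖ P, Z)` have finite dimension (`finiteDimensional_relH1`).
This comes from a finite open cover by the pieces punctured at the marked points, two slit annuli
for each edge and a disc around each marked zero. The pieces have finite Betti number by the genus
condition, the other members are parametrized by convex sets, and all overlaps have finitely many
path components. Modulo a space of finite dimension, the class of any path then depends on its end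
points only, as a difference of potentials (`finite_path_components_comparison`,
`pathClass_sub_mem_of_cover`). A relative cycle has its boundary in the finite set `Z`, which leaves
finitely many dimensions. -/

namespace SingH

section

variable {X : Type*} [TopologicalSpace X]

/-! ### Affine singular simplices, concatenation and homotopy of paths. -/

section Affine

variable {E : Type*} [AddCommGroup E] [Module ℝ E] [TopologicalSpace E] [ContinuousAdd E]
  [ContinuousSMul ℝ E]

/-- The singular simplex `x ↦ f (∑ i, x i • a i)`. -/
def affineSimplex (f : C(E, X)) {n : ℕ} (a : Fin (n + 1) → E) : Simplex n X where
  toFun x := f (∑ i, x i • a i)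
  continuous_toFun := by
    refine f.continuous.comp (continuous_finsetSum _ fun i _ => ?_)
    exact (((continuous_apply i).comp continuous_subtype_val).smul continuous_const)

theorem affineSimplex_apply (f : C(E, X)) {n : ℕ} (a : Fin (n + 1) → E)
    (x : stdSimplex ℝ (Fin (n + 1))) : affineSimplex f a x = f (∑ i, x i • a i) := rfl

theorem affineSimplex_vertex (f : C(E, X)) {n : ℕ} (a : Fin (n + 1) → E) (i : Fin (n + 1)) :
    affineSimplex f a (stdSimplex.vertex i) = f (a i) := by
  rw [affineSimplex_apply]
  simp [Pi.single_apply]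

theorem face_affineSimplex (f : C(E, X)) {n : ℕ} (a : Fin (n + 2) → E) (i : Fin (n + 2)) :
    face i (affineSimplex f a) = affineSimplex f (a ∘ i.succAbove) := by
  ext x
  change f (∑ j, (stdSimplex.map i.succAbove x) j • a j) = f (∑ j, x j • a (i.succAbove j))
  congr 1
  simp only [stdSimplex.map_coe, FunOnFinite.linearMap_apply_apply, Finset.sum_smul]
  rw [← Finset.sum_fiberwise Finset.univ i.succAbove]
  refine Finset.sum_congr rfl fun j _ => Finset.sum_congr rfl fun k hk => ?_
  rw [(Finset.mem_filter.1 hk).2]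

theorem range_affineSimplex_subset (f : C(E, X)) {n : ℕ} (a : Fin (n + 1) → E) :
    range (affineSimplex f a) ⊆ f '' convexHull ℝ (range a) := by
  rintro _ ⟨x, rfl⟩
  refine ⟨_, ?_, rfl⟩
  refine (convex_convexHull ℝ _).sum_mem (fun i _ => x.2.1 i) x.2.2 fun i _ => ?_
  exact subset_convexHull ℝ _ (mem_range_self i)

/-- The path `f` along the segment from `a` to `b`. -/
def segPath (f : C(E, X)) (a b : E) : Simplex 1 X := affineSimplex f ![a, b]

theorem segPath_apply (f : C(E, X)) (a b : E) (x : stdSimplex ℝ (Fin 2)) :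
    segPath f a b x = f (x 0 • a + x 1 • b) := by
  simp [segPath, affineSimplex_apply, Fin.sum_univ_two]

theorem segPath_vertex_zero (f : C(E, X)) (a b : E) :
    segPath f a b (stdSimplex.vertex 0) = f a := affineSimplex_vertex f _ 0

theorem segPath_vertex_one (f : C(E, X)) (a b : E) :
    segPath f a b (stdSimplex.vertex 1) = f b := affineSimplex_vertex f _ 1

theorem range_segPath_subset (f : C(E, X)) (a b : E) :
    range (segPath f a b) ⊆ f '' segment ℝ a b := by
  refine (range_affineSimplex_subset f _).trans ?_
  rw [Matrix.range_cons, Matrix.range_cons, Matrix.range_empty, union_empty, singleton_union,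
    convexHull_pair]

/-- This is the boundary of the affine triangle on `a`, `b`, `c`. The triangle may be degenerate: `a
= b = c` shows that a constant path is a boundary. -/
theorem segPath_add (f : C(E, X)) {Y : Set X} (hf : range f ⊆ Y) (a b c : E) :
    (Finsupp.single (segPath f a b) 1 + Finsupp.single (segPath f b c) 1
      - Finsupp.single (segPath f a c) 1 : Chain 1 X) ∈ (chainsIn 2 Y).map (boundary 1) := by
  refine ⟨Finsupp.single (affineSimplex f ![a, b, c]) 1, ?_, ?_⟩
  · refine Finsupp.single_mem_supported ℂ _ ?_
    exact ((range_affineSimplex_subset f _).trans (image_subset_range _ _)).trans hf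
  · rw [boundary, Finsupp.linearCombination_single, one_smul]
    refine (Fin.sum_univ_three _).trans ?_
    have h0 : ![a, b, c] ∘ (0 : Fin 3).succAbove = ![b, c] := by
      ext i; fin_cases i <;> rfl
    have h1 : ![a, b, c] ∘ (1 : Fin 3).succAbove = ![a, c] := by
      ext i; fin_cases i <;> rfl
    have h2 : ![a, b, c] ∘ (2 : Fin 3).succAbove = ![a, b] := by
      ext i; fin_cases i <;> rfl
    rw [face_affineSimplex, face_affineSimplex, face_affineSimplex, h0, h1, h2]
    change Finsupp.single (segPath f b c) _ + Finsupp.single (segPath f a c) _ +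
      Finsupp.single (segPath f a b) _ = _
    simp only [Fin.val_zero, Fin.val_one, Fin.val_two, pow_zero, pow_one, Finsupp.single_neg]
    norm_num
    abel

end Affine

/-- The constant simplex at a point. -/
def point (x : X) : Simplex 0 X := ContinuousMap.const _ x

theorem eq_point (σ : Simplex 0 X) : σ = point (σ (stdSimplex.vertex 0)) := by
  ext y
  exact congrArg σ (Subsingleton.elim _ _)

theorem face_path_zero (σ : Simplex 1 X) : face 0 σ = point (σ (stdSimplex.vertex 1)) := by
  rw [eq_point (face 0 σ)]
  change point (σ (stdSimplex.map _ _)) = _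
  rw [stdSimplex.map_vertex]
  rfl

theorem face_path_one (σ : Simplex 1 X) : face 1 σ = point (σ (stdSimplex.vertex 0)) := by
  rw [eq_point (face 1 σ)]
  change point (σ (stdSimplex.map _ _)) = _
  rw [stdSimplex.map_vertex]
  rfl

theorem boundary_single_path (σ : Simplex 1 X) :
    boundary 0 (Finsupp.single σ 1) = Finsupp.single (point (σ (stdSimplex.vertex 1))) 1
      - Finsupp.single (point (σ (stdSimplex.vertex 0))) 1 := by
  rw [boundary, Finsupp.linearCombination_single, one_smul]
  refine (Fin.sum_univ_two _).trans ?_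
  rw [face_path_zero, face_path_one]
  simp [sub_eq_add_neg]

/-- A path, as a map on the real line that is constant outside of `[0, 1]`. -/
noncomputable def lineMap (σ : Simplex 1 X) : C(ℝ, X) where
  toFun t := σ (stdSimplexHomeomorphUnitInterval.symm (projIcc (0 : ℝ) 1 zero_le_one t))
  continuous_toFun := by fun_prop

theorem lineMap_range (σ : Simplex 1 X) : range (lineMap σ) ⊆ range σ := by
  rintro _ ⟨t, rfl⟩
  exact mem_range_self _

theorem segPath_lineMap (σ : Simplex 1 X) : segPath (lineMap σ) 0 1 = σ := by
  ext x
  rw [segPath_apply]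
  change σ _ = σ x
  congr 1
  rw [Homeomorph.symm_apply_eq]
  have h0 : 0 ≤ x 1 := x.2.1 1
  have h1 : x 1 ≤ 1 := stdSimplex.le_one x 1
  have : x 0 • (0 : ℝ) + x 1 • 1 = x 1 := by simp
  rw [this, projIcc_of_mem zero_le_one ⟨h0, h1⟩]
  apply Subtype.ext
  rfl

theorem lineMap_one (σ : Simplex 1 X) {t : ℝ} (ht : 1 ≤ t) :
    lineMap σ t = σ (stdSimplex.vertex 1) := by
  have := segPath_vertex_one (lineMap σ) 0 1
  rw [segPath_lineMap] at this
  rw [this]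
  change σ _ = σ _
  rw [projIcc_of_right_le _ ht, projIcc_right]

theorem lineMap_zero (σ : Simplex 1 X) {t : ℝ} (ht : t ≤ 0) :
    lineMap σ t = σ (stdSimplex.vertex 0) := by
  have := segPath_vertex_zero (lineMap σ) 0 1
  rw [segPath_lineMap] at this
  rw [this]
  change σ _ = σ _
  rw [projIcc_of_le_left _ ht, projIcc_left]

theorem exists_path_of_joinedIn {A : Set X} {x y : X} (h : JoinedIn A x y) :
    ∃ σ : Simplex 1 X, range σ ⊆ A ∧ σ (stdSimplex.vertex 0) = x ∧
      σ (stdSimplex.vertex 1) = y := by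
  obtain ⟨γ, hγ⟩ := h
  refine ⟨segPath ⟨γ.extend, γ.continuous_extend⟩ 0 1, ?_, ?_, ?_⟩
  · refine (range_segPath_subset _ _ _).trans ?_
    rintro _ ⟨t, -, rfl⟩
    exact hγ _
  · rw [segPath_vertex_zero]
    exact γ.extend_zero
  · rw [segPath_vertex_one]
    exact γ.extend_one

/-- Concatenation of paths is additive up to boundaries. -/
theorem exists_concat {O Y : Set X} (hO : O ⊆ Y) (σ τ : Simplex 1 X) (hσ : range σ ⊆ O)
    (hτ : range τ ⊆ O) (h : σ (stdSimplex.vertex 1) = τ (stdSimplex.vertex 0)) :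
    ∃ ρ : Simplex 1 X, range ρ ⊆ O ∧ ρ (stdSimplex.vertex 0) = σ (stdSimplex.vertex 0) ∧
      ρ (stdSimplex.vertex 1) = τ (stdSimplex.vertex 1) ∧
      (Finsupp.single σ 1 + Finsupp.single τ 1 - Finsupp.single ρ 1 : Chain 1 X) ∈
        (chainsIn 2 Y).map (boundary 1) := by
  -- `σ` runs over `[-1, 0]` and `τ` over `[0, 1]`, so the degenerate triangle on `-1, 0, 1` gives
  -- the relation.
  let f : C(ℝ, X) := ⟨fun t => if t ≤ 0 then lineMap σ (t + 1) else lineMap τ t, by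
    refine Continuous.if_le ?_ ?_ continuous_id continuous_const ?_
    · fun_prop
    · fun_prop
    · rintro t rfl
      rw [lineMap_one σ (by simp), lineMap_zero τ le_rfl, h]⟩
  have hf : range f ⊆ O := by
    rintro _ ⟨t, rfl⟩
    change (if t ≤ 0 then lineMap σ (t + 1) else lineMap τ t) ∈ O
    split_ifs
    · exact hσ (lineMap_range σ (mem_range_self _))
    · exact hτ (lineMap_range τ (mem_range_self _))
  have h1 : segPath f (-1) 0 = σ := by
    conv_rhs => rw [← segPath_lineMap σ]
    ext x
    rw [segPath_apply, segPath_apply]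
    have h2 := stdSimplex.add_eq_one x
    change (if x 0 • (-1 : ℝ) + x 1 • 0 ≤ 0 then _ else _) = _
    rw [if_pos (by simp)]
    congr 1
    simp only [smul_eq_mul]
    linarith
  have h2 : segPath f 0 1 = τ := by
    conv_rhs => rw [← segPath_lineMap τ]
    ext x
    rw [segPath_apply, segPath_apply]
    change (if x 0 • (0 : ℝ) + x 1 • 1 ≤ 0 then lineMap σ (x 0 • (0 : ℝ) + x 1 • 1 + 1)
      else lineMap τ (x 0 • (0 : ℝ) + x 1 • 1)) = _
    split_ifs with hx
    · rw [lineMap_one σ (by simp), lineMap_zero τ hx, h]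
    · rfl
  refine ⟨segPath f (-1) 1, ?_, ?_, ?_, ?_⟩
  · exact ((range_segPath_subset _ _ _).trans (image_subset_range _ _)).trans hf
  · rw [segPath_vertex_zero, ← h1, segPath_vertex_zero]
  · rw [segPath_vertex_one, ← h2, segPath_vertex_one]
  · have := segPath_add f (hf.trans hO) (-1) 0 1
    rwa [h1, h2] at this

/-- Paths that are homotopic relative to their end points differ by a boundary. -/
theorem single_sub_single_mem_of_homotopy {Y : Set X} (f : C(ℝ × ℝ, X)) (hf : range f ⊆ Y)
    (h0 : ∀ s, f (s, 0) = f (0, 0)) (h1 : ∀ s, f (s, 1) = f (0, 1)) :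
    (Finsupp.single (segPath f (0, 0) (0, 1)) 1 - Finsupp.single (segPath f (1, 0) (1, 1)) 1 :
      Chain 1 X) ∈ (chainsIn 2 Y).map (boundary 1) := by
  have e0 : segPath f (0, 0) (0, 0) = segPath f (0, 0) (1, 0) := by
    ext x
    simp only [segPath_apply]
    simp [h0]
  have e1 : segPath f (0, 1) (0, 1) = segPath f (0, 1) (1, 1) := by
    ext x
    have h2 := stdSimplex.add_eq_one x
    simp only [segPath_apply]
    simp [h2, h1]
  -- The unit square is cut along its diagonal into two triangles. The two sides on which `f` is
  -- constant are replaced by constant paths at a corner, which `k3` and `k4` show to be boundaries.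
  have k1 := segPath_add f hf (0, 0) (0, 1) (1, 1)
  have k2 := segPath_add f hf (0, 0) (1, 0) (1, 1)
  have k3 := segPath_add f hf (0, 0) (0, 0) (0, 0)
  have k4 := segPath_add f hf (0, 1) (0, 1) (0, 1)
  rw [← e1] at k1
  rw [← e0] at k2
  have := Submodule.add_mem _ (Submodule.sub_mem _ (Submodule.sub_mem _ k1 k2) k4) k3
  convert this using 1
  abel

end

end SingH

/-! ### Finite dimensionality of relative homology from a finite open cover. -/

namespace SingH

section

variable {X : Type*} [TopologicalSpace X]

/-- The class of a path modulo relative boundaries. -/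
noncomputable def pathClass (Y A : Set X) (σ : Simplex 1 X) : Chain 1 X ⧸ relBoundaries Y A :=
  (relBoundaries Y A).mkQ (Finsupp.single σ 1)

theorem mkQ_eq_zero_of_mem_map_boundary {Y A : Set X} {c : Chain 1 X}
    (hc : c ∈ (chainsIn 2 Y).map (boundary 1)) : (relBoundaries Y A).mkQ c = 0 := by
  rw [Submodule.mkQ_apply, Submodule.Quotient.mk_eq_zero]
  exact Submodule.mem_sup_left hc

/-- The differences of paths in `O` with common end points span a space of finite dimension of
one-chains modulo relative boundaries of `(Y, A)`. -/
def LoopFinite (Y A O : Set X) : Prop :=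
  ∃ F : Submodule ℂ (Chain 1 X ⧸ relBoundaries Y A), FiniteDimensional ℂ F ∧
    ∀ σ τ : Simplex 1 X, range σ ⊆ O → range τ ⊆ O →
      σ (stdSimplex.vertex 0) = τ (stdSimplex.vertex 0) →
      σ (stdSimplex.vertex 1) = τ (stdSimplex.vertex 1) →
      pathClass Y A σ - pathClass Y A τ ∈ F

/-- `O` has finitely many path components. -/
def FinJoined (O : Set X) : Prop :=
  ∃ T : Set X, T.Finite ∧ ∀ x ∈ O, ∃ t ∈ T, JoinedIn O x t

theorem _root_.IsPathConnected.finJoined {O : Set X} (h : IsPathConnected O) : FinJoined O := by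
  obtain ⟨t, -, ht⟩ := h
  exact ⟨{t}, finite_singleton t, fun x hx => ⟨t, rfl, (ht hx).symm⟩⟩

theorem finJoined_empty : FinJoined (∅ : Set X) :=
  ⟨∅, finite_empty, fun _ hx => hx.elim⟩

theorem FinJoined.union {O O' : Set X} (h : FinJoined O) (h' : FinJoined O') :
    FinJoined (O ∪ O') := by
  obtain ⟨T, hT, hO⟩ := h
  obtain ⟨T', hT', hO'⟩ := h'
  refine ⟨T ∪ T', hT.union hT', ?_⟩
  rintro x (hx | hx)
  · obtain ⟨t, ht, hxt⟩ := hO x hx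
    exact ⟨t, Or.inl ht, hxt.mono subset_union_left⟩
  · obtain ⟨t, ht, hxt⟩ := hO' x hx
    exact ⟨t, Or.inr ht, hxt.mono subset_union_right⟩

theorem pathClass_add {Y A : Set X} {E : Type*} [AddCommGroup E] [Module ℝ E] [TopologicalSpace E]
    [ContinuousAdd E] [ContinuousSMul ℝ E] (f : C(E, X)) (hf : range f ⊆ Y) (a b c : E) :
    pathClass Y A (segPath f a b) + pathClass Y A (segPath f b c) =
      pathClass Y A (segPath f a c) := by
  have := mkQ_eq_zero_of_mem_map_boundary (A := A) (segPath_add f hf a b c)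
  rw [map_sub, map_add] at this
  exact sub_eq_zero.1 this

/-- By a Lebesgue number argument a path splits into finitely many segments, each inside one member
of the cover. Classes of segments add up and the differences of `ψ` telescope, so the local estimate
becomes global. -/
theorem pathClass_sub_mem_of_cover {ι : Type*} {Y A : Set X} (O : ι → Set X)
    (hO : ∀ j, IsOpen (O j)) (hcov : Y ⊆ ⋃ j, O j)
    (N : Submodule ℂ (Chain 1 X ⧸ relBoundaries Y A))
    (ψ : X → Chain 1 X ⧸ relBoundaries Y A)
    (h : ∀ j (σ : Simplex 1 X), range σ ⊆ O j → range σ ⊆ Y → pathClass Y A σ -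
      (ψ (σ (stdSimplex.vertex 1)) - ψ (σ (stdSimplex.vertex 0))) ∈ N)
    (σ : Simplex 1 X) (hσ : range σ ⊆ Y) :
    pathClass Y A σ - (ψ (σ (stdSimplex.vertex 1)) - ψ (σ (stdSimplex.vertex 0))) ∈ N := by
  set f := lineMap σ with hf
  have hfY : range f ⊆ Y := (lineMap_range σ).trans hσ
  obtain ⟨t, ht0, htm, ⟨n, hn⟩, ht⟩ := exists_monotone_Icc_subset_open_cover_unitInterval
    (c := fun j => (fun s : unitInterval => f s) ⁻¹' O j)
    (fun j => (hO j).preimage (by fun_prop)) (fun s _ => by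
      obtain ⟨j, hj⟩ := mem_iUnion.1 (hcov (hfY (mem_range_self (s : ℝ))))
      exact mem_iUnion.2 ⟨j, hj⟩)
  have key : ∀ m : ℕ, pathClass Y A (segPath f (t 0 : ℝ) (t m)) - (ψ (f (t m)) - ψ (f (t 0))) ∈ N := by
    intro m
    induction m with
    | zero =>
      -- The class `m` of a constant path satisfies `m + m = m`, hence vanishes.
      have := pathClass_add (A := A) f hfY (t 0 : ℝ) (t 0) (t 0)
      rw [add_eq_left] at this
      rw [this]
      simp
    | succ m ih =>
      obtain ⟨j, hj⟩ := ht m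
      have h1 : range (segPath f (t m : ℝ) (t (m + 1))) ⊆ O j := by
        refine (range_segPath_subset f _ _).trans ?_
        rintro _ ⟨s, hs, rfl⟩
        rw [segment_eq_Icc (show (t m : ℝ) ≤ t (m + 1) from htm (Nat.le_succ m))] at hs
        exact hj (show (⟨s, (t m).2.1.trans hs.1, hs.2.trans (t (m + 1)).2.2⟩ : unitInterval) ∈ _
          from ⟨hs.1, hs.2⟩)
      have h2 := h j _ h1 ((range_segPath_subset f _ _).trans
        ((image_subset_range _ _).trans hfY))
      rw [segPath_vertex_zero, segPath_vertex_one] at h2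
      have h3 := pathClass_add (A := A) f hfY (t 0 : ℝ) (t m) (t (m + 1))
      rw [← h3]
      convert N.add_mem ih h2 using 1
      abel
  have h1 := key n
  have h2 := hn n le_rfl
  rw [ht0, h2] at h1
  have h3 := segPath_vertex_zero f (0 : ℝ) 1
  have h4 := segPath_vertex_one f (0 : ℝ) 1
  rw [hf, segPath_lineMap, ← hf] at h3 h4
  change pathClass Y A (segPath f 0 1) - (ψ (f 1) - ψ (f 0)) ∈ N at h1
  rwa [← h3, ← h4, hf, segPath_lineMap] at h1

/-- Join a base point of each `O j` to every `x ∈ O j` by a path `p j x`. Modulo the loops of `O j`,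
a path in `O j` is the difference of the values of `p j` at its ends. The potentials `p j` and `p k`
differ by a constant on each path component of `O j ∩ O k`, up to loops; these finitely many
constants are put into `N`. The potential `ψ` may then use any member of the cover that contains the
point. -/
theorem finite_path_components_comparison {ι : Type*} [Finite ι] {Y A : Set X} (O : ι → Set X)
    (hOY : ∀ j, O j ⊆ Y) (hconn : ∀ j, IsPathConnected (O j))
    (hloop : ∀ j, LoopFinite Y A (O j)) (hfin : ∀ j k, FinJoined (O j ∩ O k)) :
    ∃ (N : Submodule ℂ (Chain 1 X ⧸ relBoundaries Y A))
      (ψ : X → Chain 1 X ⧸ relBoundaries Y A), FiniteDimensional ℂ N ∧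
      ∀ j (σ : Simplex 1 X), range σ ⊆ O j → pathClass Y A σ -
        (ψ (σ (stdSimplex.vertex 1)) - ψ (σ (stdSimplex.vertex 0))) ∈ N := by
  choose F hFfin hF using hloop
  choose T hTfin hT using hfin
  choose b hbO hb using hconn
  have hp : ∀ j x, ∃ p : Simplex 1 X, x ∈ O j → range p ⊆ O j ∧ p (stdSimplex.vertex 0) = b j ∧
      p (stdSimplex.vertex 1) = x := by
    intro j x
    by_cases hx : x ∈ O j
    · obtain ⟨p, hp⟩ := exists_path_of_joinedIn (hb j hx)
      exact ⟨p, fun _ => hp⟩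
    · exact ⟨ContinuousMap.const _ x, fun h => absurd h hx⟩
  choose p hp using hp
  -- The index `i` only witnesses that `x` is covered; `m` is chosen before it and does not depend
  -- on it. Uncovered points get the value `0`.
  have hψ : ∀ x, ∃ m : Chain 1 X ⧸ relBoundaries Y A, ∀ i, x ∈ O i →
      ∃ j, x ∈ O j ∧ m = pathClass Y A (p j x) := by
    intro x
    by_cases hx : ∃ j, x ∈ O j
    · obtain ⟨j, hj⟩ := hx
      exact ⟨_, fun _ _ => ⟨j, hj, rfl⟩⟩
    · exact ⟨0, fun i hi => absurd ⟨i, hi⟩ hx⟩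
  choose ψ hψ using hψ
  set Q : Set (Chain 1 X ⧸ relBoundaries Y A) :=
    ⋃ j, ⋃ k, (fun t => pathClass Y A (p j t) - pathClass Y A (p k t)) '' T j k with hQ
  have hQfin : Q.Finite := finite_iUnion fun j => finite_iUnion fun k => (hTfin j k).image _
  have hspan : FiniteDimensional ℂ (Submodule.span ℂ Q) := FiniteDimensional.span_of_finite ℂ hQfin
  set N := (⨆ j, F j) ⊔ Submodule.span ℂ Q with hN
  have hFN : ∀ j, F j ≤ N := fun j => (le_iSup F j).trans le_sup_left
  have stepA : ∀ j (σ : Simplex 1 X), range σ ⊆ O j → pathClass Y A σ -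
      (pathClass Y A (p j (σ (stdSimplex.vertex 1))) -
        pathClass Y A (p j (σ (stdSimplex.vertex 0)))) ∈ N := by
    intro j σ hσ
    obtain ⟨h1, h2, h3⟩ := hp j _ (hσ (mem_range_self (stdSimplex.vertex 0)))
    obtain ⟨h4, h5, h6⟩ := hp j _ (hσ (mem_range_self (stdSimplex.vertex 1)))
    obtain ⟨ρ, hρ, hρ0, hρ1, hρc⟩ := exists_concat (hOY j) _ σ h1 hσ h3
    have h7 := hFN j (hF j ρ _ hρ h4 (by rw [hρ0, h2, h5]) (by rw [hρ1, h6]))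
    have h8 := mkQ_eq_zero_of_mem_map_boundary (A := A) hρc
    rw [map_sub, map_add, sub_eq_zero] at h8
    change pathClass Y A _ + pathClass Y A _ = pathClass Y A _ at h8
    rw [← h8] at h7
    convert h7 using 1
    abel
  have stepB : ∀ j k x, x ∈ O j → x ∈ O k →
      pathClass Y A (p j x) - pathClass Y A (p k x) ∈ N := by
    intro j k x hj hk
    obtain ⟨t, ht, hxt⟩ := hT j k x ⟨hj, hk⟩
    obtain ⟨τ, hτ, hτ0, hτ1⟩ := exists_path_of_joinedIn hxt
    have h1 := stepA j τ (hτ.trans inter_subset_left)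
    have h2 := stepA k τ (hτ.trans inter_subset_right)
    have h3 : pathClass Y A (p j t) - pathClass Y A (p k t) ∈ N :=
      (le_sup_right : _ ≤ N) (Submodule.subset_span
        (mem_iUnion.2 ⟨j, mem_iUnion.2 ⟨k, mem_image_of_mem _ ht⟩⟩))
    rw [hτ0, hτ1] at h1 h2
    convert N.add_mem (N.sub_mem h1 h2) h3 using 1
    abel
  refine ⟨N, ψ, ?_, ?_⟩
  · infer_instance
  · intro j σ hσ
    have hx := hσ (mem_range_self (stdSimplex.vertex 0))
    have hy := hσ (mem_range_self (stdSimplex.vertex 1))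
    obtain ⟨k, hk, hk'⟩ := hψ _ j hx
    obtain ⟨l, hl, hl'⟩ := hψ _ j hy
    rw [hk', hl']
    convert N.add_mem (N.sub_mem (stepA j σ hσ) (stepB j k _ hx hk)) (stepB j l _ hy hl) using 1
    abel

theorem finiteDimensional_chainsIn_zero {A : Set X} (hA : A.Finite) :
    FiniteDimensional ℂ (chainsIn 0 A : Submodule ℂ (Chain 0 X)) := by
  rw [chainsIn, Finsupp.supported_eq_span_single]
  refine FiniteDimensional.span_of_finite ℂ (Finite.image _ ?_)
  refine (hA.image point).subset fun σ hσ => ?_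
  exact ⟨_, hσ (mem_range_self _), (eq_point σ).symm⟩

/-- The relative homology of a pair is finite dimensional if the space has a good finite open
cover and the subspace is finite. -/
theorem finiteDimensional_H1_of_cover {ι : Type*} [Finite ι] {Y A : Set X} (hA : A.Finite)
    (O : ι → Set X) (hO : ∀ j, IsOpen (O j)) (hOY : ∀ j, O j ⊆ Y) (hcov : Y ⊆ ⋃ j, O j)
    (hconn : ∀ j, IsPathConnected (O j))
    (hloop : ∀ j, LoopFinite Y A (O j)) (hfin : ∀ j k, FinJoined (O j ∩ O k)) :
    FiniteDimensional ℂ (H1 Y A) := by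
  obtain ⟨N, ψ, hN, h⟩ := finite_path_components_comparison O hOY hconn hloop hfin
  have h' := pathClass_sub_mem_of_cover O hO hcov N ψ (fun j σ hσ _ => h j σ hσ)
  -- The class of a chain `c` in `Y` is congruent to `Ψ (∂ c)` modulo `N`. For a relative cycle `∂
  -- c` is a chain of the finite set `A ∩ Y`, so the homology embeds, by `j` below, into `N` plus a
  -- space of finite dimension.
  let Ψ : Chain 0 X →ₗ[ℂ] Chain 1 X ⧸ relBoundaries Y A :=
    Finsupp.linearCombination ℂ (fun s : Simplex 0 X => ψ (s (stdSimplex.vertex 0)))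
  have hL : chainsIn 1 Y ≤ N.comap ((relBoundaries Y A).mkQ - Ψ.comp (boundary 0)) := by
    rw [chainsIn, Finsupp.supported_eq_span_single, Submodule.span_le]
    rintro _ ⟨σ, hσ, rfl⟩
    have := h' σ hσ
    change (relBoundaries Y A).mkQ (Finsupp.single σ 1) - Ψ (boundary 0 (Finsupp.single σ 1)) ∈ N
    rw [boundary_single_path, map_sub]
    simpa [Ψ, point, pathClass] using this
  have := finiteDimensional_chainsIn_zero (hA.inter_of_left Y)
  let j : H1 Y A →ₗ[ℂ] Chain 1 X ⧸ relBoundaries Y A :=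
    Submodule.mapQ _ _ (relCycles Y A).subtype (fun _ hx => hx)
  have hj : LinearMap.ker j = ⊥ := by
    rw [LinearMap.ker_eq_bot']
    intro m
    obtain ⟨c, rfl⟩ := Submodule.Quotient.mk_surjective _ m
    intro hc
    erw [Submodule.mapQ_apply, Submodule.Quotient.mk_eq_zero] at hc
    rw [Submodule.Quotient.mk_eq_zero]
    exact hc
  have hr : ∀ m, j m ∈ N ⊔ (chainsIn 0 (A ∩ Y)).map Ψ := by
    intro m
    obtain ⟨⟨c, hc1, hc2⟩, rfl⟩ := Submodule.Quotient.mk_surjective _ m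
    have h1 := hL hc1
    refine Submodule.mem_sup.2 ⟨_, h1, _, ⟨_, hc2, rfl⟩, ?_⟩
    change (_ - Ψ _) + Ψ _ = _
    rw [sub_add_cancel]
    rfl
  exact Module.Finite.of_injective (j.codRestrict _ hr)
    (LinearMap.ker_eq_bot.1 (by rw [LinearMap.ker_codRestrict, hj]))

/-- A subset with finite dimensional homology is loop finite. -/
theorem LoopFinite.of_finiteDimensional {O Y A : Set X} (hOY : O ⊆ Y)
    [FiniteDimensional ℂ (H1 O (∅ : Set X))] : LoopFinite Y A O := by
  have hB : relBoundaries O (∅ : Set X) ≤ relBoundaries Y A :=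
    sup_le_sup (Submodule.map_mono (chainsIn_mono 2 hOY))
      (chainsIn_mono 1 (by rw [empty_inter]; exact empty_subset _))
  let j : H1 O (∅ : Set X) →ₗ[ℂ] Chain 1 X ⧸ relBoundaries Y A :=
    Submodule.mapQ _ _ (relCycles O ∅).subtype (fun _ hx => hB hx)
  refine ⟨LinearMap.range j, inferInstance, fun σ τ hσ hτ h0 h1 => ?_⟩
  have hc : (Finsupp.single σ 1 - Finsupp.single τ 1 : Chain 1 X) ∈ relCycles O ∅ := by
    refine ⟨Submodule.sub_mem _ (Finsupp.single_mem_supported ℂ _ hσ)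
      (Finsupp.single_mem_supported ℂ _ hτ), ?_⟩
    change boundary 0 (Finsupp.single σ 1 - Finsupp.single τ 1 : Chain 1 X) ∈
      chainsIn 0 (∅ ∩ O)
    rw [map_sub, boundary_single_path, boundary_single_path, h0, h1, sub_self]
    exact Submodule.zero_mem _
  refine ⟨Submodule.Quotient.mk ⟨_, hc⟩, ?_⟩
  rfl

/-- A subset that is parametrized by a convex set is loop finite. -/
theorem LoopFinite.of_convex {E : Type*} [NormedAddCommGroup E] [NormedSpace ℝ E] {K : Set E}
    (hK : Convex ℝ K) {O Y A : Set X} (s : E → X) (r : X → E) (hs : ContinuousOn s K)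
    (hsY : MapsTo s K Y) (hr : ContinuousOn r O) (hrK : MapsTo r O K)
    (hsr : ∀ x ∈ O, s (r x) = x) : LoopFinite Y A O := by
  refine ⟨⊥, inferInstance, fun (σ τ : Simplex 1 X) hσ hτ h0 h1 => ?_⟩
  -- The straight-line homotopy in `K` has to be defined on the whole plane; clamping its parameter
  -- keeps the combination convex.
  let u : ℝ → ℝ := fun t => projIcc (0 : ℝ) 1 zero_le_one t
  let g : ℝ × ℝ → E := fun q => (1 - u q.1) • r (lineMap σ q.2) + u q.1 • r (lineMap τ q.2)
  have hσO : ∀ t, lineMap σ t ∈ O := fun t => hσ (lineMap_range σ (mem_range_self t))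
  have hτO : ∀ t, lineMap τ t ∈ O := fun t => hτ (lineMap_range τ (mem_range_self t))
  have hu : Continuous u := continuous_subtype_val.comp continuous_projIcc
  have hg : Continuous g := by
    have h1 : Continuous fun t => r (lineMap σ t) := hr.comp_continuous (by fun_prop) hσO
    have h2 : Continuous fun t => r (lineMap τ t) := hr.comp_continuous (by fun_prop) hτO
    exact (((continuous_const (y := (1 : ℝ))).sub (hu.comp continuous_fst)).smul (h1.comp continuous_snd)).add
      ((hu.comp continuous_fst).smul (h2.comp continuous_snd))
  have hgK : ∀ q, g q ∈ K := fun q => hK (hrK (hσO _)) (hrK (hτO _))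
    (sub_nonneg.2 (projIcc (0 : ℝ) 1 zero_le_one q.1).2.2) (projIcc (0 : ℝ) 1 zero_le_one q.1).2.1
    (by simp [u])
  let f : C(ℝ × ℝ, X) := ⟨fun q => s (g q), hs.comp_continuous hg hgK⟩
  have hfY : range f ⊆ Y := by
    rintro _ ⟨q, rfl⟩
    exact hsY (hgK q)
  have key := single_sub_single_mem_of_homotopy f hfY
    (fun t => by
      change s (g _) = s (g _)
      congr 1
      simp only [g]
      rw [lineMap_zero σ le_rfl, lineMap_zero τ le_rfl, h0, ← add_smul, ← add_smul]
      simp)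
    (fun t => by
      change s (g _) = s (g _)
      congr 1
      simp only [g]
      rw [lineMap_one σ le_rfl, lineMap_one τ le_rfl, h1, ← add_smul, ← add_smul]
      simp)
  have e0 : segPath f (0, 0) (0, 1) = σ := by
    conv_rhs => rw [← segPath_lineMap σ]
    ext x
    rw [segPath_apply, segPath_apply]
    change s (g _) = _
    simp [g, u, hsr _ (hσO _)]
  have e1 : segPath f (1, 0) (1, 1) = τ := by
    conv_rhs => rw [← segPath_lineMap τ]
    ext x
    rw [segPath_apply, segPath_apply]
    change s (g _) = _
    simp [g, u, hsr _ (hτO _), stdSimplex.add_eq_one]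
  rw [e0, e1] at key
  have := mkQ_eq_zero_of_mem_map_boundary (A := A) key
  rw [map_sub] at this
  exact this

end

end SingH

/-! ### Discs in surfaces and removal of finitely many points. -/

section Surface

/-- Polar coordinates exhibit the punctured disc as the image of a convex strip. -/
theorem isPathConnected_punctured_ball (c : ℂ) {ε : ℝ} (hε : 0 < ε) :
    IsPathConnected (Metric.ball c ε \ {c}) := by
  have h : Metric.ball c ε \ {c} =
      (fun q : ℝ × ℝ => c + q.1 * Complex.exp (q.2 * Complex.I)) '' (Ioo 0 ε ×ˢ univ) := by
    ext z
    constructor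
    · rintro ⟨hz, hzc⟩
      have hz0 : z - c ≠ 0 := sub_ne_zero.2 hzc
      refine ⟨(‖z - c‖, Complex.arg (z - c)), ⟨⟨norm_pos_iff.2 hz0, ?_⟩, mem_univ _⟩, ?_⟩
      · simpa [dist_eq_norm] using hz
      · simp only [Complex.norm_mul_exp_arg_mul_I]
        ring
    · rintro ⟨⟨ρ, θ⟩, ⟨⟨h0, h1⟩, -⟩, rfl⟩
      constructor
      · simpa [dist_eq_norm, Complex.norm_exp_ofReal_mul_I, abs_of_pos h0] using h1
      · simp only [mem_singleton_iff, add_eq_left, mul_eq_zero, Complex.exp_ne_zero, or_false,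
          Complex.ofReal_eq_zero]
        exact h0.ne'
  rw [h]
  refine IsPathConnected.image ?_ (by fun_prop)
  exact ((convex_Ioo 0 ε).prod convex_univ).isPathConnected ⟨(ε / 2, 0), by simp [hε]⟩

variable {S : Type*} [TopologicalSpace S]

theorem exists_disc [ChartedSpace ℂ S] {U : Set S} (hU : IsOpen U) {p : S} (hp : p ∈ U) :
    ∃ D : Set S, IsOpen D ∧ p ∈ D ∧ D ⊆ U ∧ IsPathConnected D ∧ IsPathConnected (D \ {p}) ∧
      ∀ Y A : Set S, D ⊆ Y → SingH.LoopFinite Y A D := by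
  set φ := chartAt ℂ p with hφ
  have hps : p ∈ φ.source := mem_chart_source ℂ p
  have ho : IsOpen (φ.target ∩ φ.symm ⁻¹' U) := φ.isOpen_inter_preimage_symm hU
  obtain ⟨ε, hε, hball⟩ := Metric.isOpen_iff.1 ho (φ p)
    ⟨φ.map_source hps, by simpa [φ.left_inv hps] using hp⟩
  have ht : Metric.ball (φ p) ε ⊆ φ.target := fun z hz => (hball hz).1
  have hc : ContinuousOn φ.symm (Metric.ball (φ p) ε) := φ.continuousOn_symm.mono ht
  have hDs : φ.symm '' Metric.ball (φ p) ε ⊆ φ.source := by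
    rintro _ ⟨z, hz, rfl⟩
    exact φ.map_target (ht hz)
  refine ⟨φ.symm '' Metric.ball (φ p) ε, ?_, ?_, ?_, ?_, ?_, ?_⟩
  · exact φ.isOpen_image_symm_of_subset_target Metric.isOpen_ball ht
  · exact ⟨φ p, Metric.mem_ball_self hε, φ.left_inv hps⟩
  · rintro _ ⟨z, hz, rfl⟩
    exact (hball hz).2
  · exact ((convex_ball _ _).isPathConnected ⟨_, Metric.mem_ball_self hε⟩).image' hc
  · have : φ.symm '' Metric.ball (φ p) ε \ {p} = φ.symm '' (Metric.ball (φ p) ε \ {φ p}) := by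
      ext x
      constructor
      · rintro ⟨⟨z, hz, rfl⟩, hx⟩
        refine ⟨z, ⟨hz, ?_⟩, rfl⟩
        rintro rfl
        exact hx (φ.left_inv hps)
      · rintro ⟨z, ⟨hz, hzp⟩, rfl⟩
        refine ⟨⟨z, hz, rfl⟩, fun h => hzp ?_⟩
        rw [mem_singleton_iff] at h ⊢
        rw [← h, φ.right_inv (ht hz)]
    rw [this]
    exact (isPathConnected_punctured_ball _ hε).image' (hc.mono sdiff_subset)
  · intro Y A hY
    refine SingH.LoopFinite.of_convex (convex_ball (φ p) ε) φ.symm φ hc ?_ (φ.continuousOn.mono hDs)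
      ?_ (fun x hx => φ.left_inv (hDs hx))
    · exact fun z hz => hY (mem_image_of_mem _ hz)
    · rintro _ ⟨z, hz, rfl⟩
      rwa [φ.right_inv (ht hz)]

/-- Take a disc `D` around `p` in `U`. The connected set `D \ {p}` lies on one side of any
separation of `U \ {p}`; adding `D` to that side would separate `U` itself. -/
theorem IsPathConnected.sdiff_singleton_of_surface [T2Space S] [ChartedSpace ℂ S] {U : Set S}
    (hU : IsOpen U) (hc : IsPathConnected U) (p : S) : IsPathConnected (U \ {p}) := by
  by_cases hp : p ∈ U
  swap
  · rwa [sdiff_singleton_eq_self hp]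
  have := ChartedSpace.locallyPathConnectedSpace ℂ S
  obtain ⟨D, hD, hpD, hDU, -, hDp, -⟩ := exists_disc hU hp
  have hsub : D \ {p} ⊆ U \ {p} := sdiff_subset_sdiff_left hDU
  have hUp : IsOpen (U \ {p}) := hU.sdiff isClosed_singleton
  refine hUp.isConnected_iff_isPathConnected.1 ⟨hDp.nonempty.mono hsub, ?_⟩
  have key : ∀ u v : Set S, IsOpen u → IsOpen v → U \ {p} ⊆ u ∪ v → ((U \ {p}) ∩ v).Nonempty →
      D \ {p} ⊆ u → ((U \ {p}) ∩ (u ∩ v)).Nonempty := by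
    intro u v hu hv huv ⟨y, hy, hyv⟩ hDu
    obtain ⟨x, hxU, hx1, hx2⟩ := hc.isConnected.isPreconnected (u ∪ D) (v ∩ (U \ {p})) (hu.union hD)
      (hv.inter hUp) (fun x hx => by
        by_cases hxp : x = p
        · exact Or.inl (Or.inr (hxp ▸ hpD))
        · rcases huv ⟨hx, hxp⟩ with h | h
          · exact Or.inl (Or.inl h)
          · exact Or.inr ⟨h, hx, hxp⟩) ⟨p, hp, Or.inr hpD⟩ ⟨y, hy.1, hyv, hy⟩
    refine ⟨x, hx2.2, ?_, hx2.1⟩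
    rcases hx1 with h | h
    · exact h
    · exact hDu ⟨h, hx2.2.2⟩
  intro u v hu hv huv hnu hnv
  by_contra hne
  have hdis : (U \ {p}) ∩ (u ∩ v) = ∅ := not_nonempty_iff_eq_empty.1 hne
  have hdis' : (D \ {p}) ∩ (u ∩ v) = ∅ :=
    subset_empty_iff.1 (hdis ▸ inter_subset_inter_left _ hsub)
  rcases isPreconnected_iff_subset_of_disjoint.1 hDp.isConnected.isPreconnected u v hu hv
    (hsub.trans huv) hdis' with h | h
  · exact hne (key u v hu hv huv hnv h)
  · exact hne (inter_comm v u ▸ key v u hv hu (union_comm u v ▸ huv) hnu h)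

theorem IsPathConnected.sdiff_finite_of_surface [T2Space S] [ChartedSpace ℂ S] {U F : Set S}
    (hF : F.Finite) (hU : IsOpen U) (hc : IsPathConnected U) : IsPathConnected (U \ F) := by
  induction F, hF using Set.Finite.induction_on with
  | empty => rwa [sdiff_empty]
  | @insert a F _ hF ih =>
    rw [← union_singleton, ← sdiff_sdiff]
    exact ih.sdiff_singleton_of_surface (hU.sdiff hF.isClosed) a

end Surface

/-! ### Collars, pieces and boxes. -/

namespace PinchedSurface

variable {V E H : Type*} [Fintype V] [Fintype E] [Fintype H] {Γ : EnhancedLevelGraph V E H}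
  {S : Type*} [TopologicalSpace S] (D : PinchedSurface Γ S)

/-- Invariance of domain is avoided: `V` is the trace of an open set of `S`, which is intersected
with the open annulus, open by assumption. -/
theorem isOpen_image_collar (e : E) {V : Set (Circle × unitInterval)} (hV : IsOpen V)
    (h : V ⊆ {p | 0 < (p.2 : ℝ) ∧ (p.2 : ℝ) < 1}) : IsOpen (D.collar e '' V) := by
  obtain ⟨W, hW, rfl⟩ := (D.isEmbedding_collar e).isInducing.isOpen_iff.1 hV
  have : D.collar e '' (D.collar e ⁻¹' W) = W ∩ D.openAnnulus e := by
    ext x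
    constructor
    · rintro ⟨p, hp, rfl⟩
      exact ⟨hp, mem_image_of_mem _ (h hp)⟩
    · rintro ⟨hx, p, hp, rfl⟩
      exact ⟨p, hx, rfl⟩
  rw [this]
  exact hW.inter (D.isOpen_collar e)

theorem vanishingCycle_disjoint_piece (e : E) (v : V) :
    Disjoint (D.vanishingCycle e) (D.piece v) := by
  rw [Set.disjoint_left]
  intro x hx hv
  have : x ∈ (⋃ e, D.collar e '' {p | (p.2 : ℝ) = 1 / 2})ᶜ :=
    D.iUnion_piece ▸ mem_iUnion.2 ⟨v, hv⟩
  exact this (mem_iUnion.2 ⟨e, hx⟩)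

theorem mem_piece_or_vanishingCycle (x : S) :
    (∃ v, x ∈ D.piece v) ∨ ∃ e, x ∈ D.vanishingCycle e := by
  by_cases hx : x ∈ ⋃ v, D.piece v
  · exact Or.inl (mem_iUnion.1 hx)
  · rw [D.iUnion_piece, mem_compl_iff, not_not] at hx
    exact Or.inr (mem_iUnion.1 hx)

theorem piece_eq_of_mem {x : S} {v w : V} (hv : x ∈ D.piece v) (hw : x ∈ D.piece w) : v = w := by
  by_contra h
  exact Set.disjoint_left.1 (D.disjoint_piece v w h) hv hw

theorem collar_notMem_range {e e' : E} (h : e ≠ e') (p : Circle × unitInterval) :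
    D.collar e p ∉ range (D.collar e') :=
  Set.disjoint_left.1 (D.disjoint_collar e e' h) (mem_range_self p)

theorem openAnnulus_subset_range (e : E) : D.openAnnulus e ⊆ range (D.collar e) :=
  image_subset_range _ _

theorem vanishingCycle_subset_openAnnulus (e : E) : D.vanishingCycle e ⊆ D.openAnnulus e := by
  refine image_mono fun p (hp : (p.2 : ℝ) = 1 / 2) => ?_
  change 0 < (p.2 : ℝ) ∧ (p.2 : ℝ) < 1
  rw [hp]
  norm_num

/-- A collar point lies on the lower piece exactly if it is below the vanishing cycle, unless the
edge is a loop. -/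
theorem collar_mem_piece_iff (e : E) (p : Circle × unitInterval) (v : V) :
    D.collar e p ∈ D.piece v ↔
      (Γ.bot e = v ∧ (p.2 : ℝ) < 1 / 2) ∨ (Γ.top e = v ∧ 1 / 2 < (p.2 : ℝ)) := by
  constructor
  · intro h
    rcases lt_trichotomy (p.2 : ℝ) (1 / 2) with hp | hp | hp
    · exact Or.inl ⟨D.piece_eq_of_mem (D.collar_mem_bot e p hp) h, hp⟩
    · exact absurd h (Set.disjoint_left.1 (D.vanishingCycle_disjoint_piece e v)
        (mem_image_of_mem _ hp))
    · exact Or.inr ⟨D.piece_eq_of_mem (D.collar_mem_top e p hp) h, hp⟩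
  · rintro (⟨rfl, hp⟩ | ⟨rfl, hp⟩)
    · exact D.collar_mem_bot e p hp
    · exact D.collar_mem_top e p hp

theorem isPathConnected_piece [ChartedSpace ℂ S] (v : V) : IsPathConnected (D.piece v) := by
  have := ChartedSpace.locallyPathConnectedSpace ℂ S
  exact (D.isOpen_piece v).isConnected_iff_isPathConnected.1 (D.isConnected_piece v)

/-! ### Strips in the collars -/

/-- The collar in logarithmic coordinates. -/
noncomputable def strip (e : E) (q : ℝ × ℝ) : S :=
  D.collar e (Circle.exp q.1, projIcc (0 : ℝ) 1 zero_le_one q.2)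

theorem continuous_strip (e : E) : Continuous (D.strip e) :=
  (D.isEmbedding_collar e).continuous.comp
    ((Circle.exp.continuous.comp continuous_fst).prodMk (continuous_projIcc.comp continuous_snd))

theorem strip_of_mem (e : E) (θ : ℝ) {t : ℝ} (ht : t ∈ unitInterval) :
    D.strip e (θ, t) = D.collar e (Circle.exp θ, ⟨t, ht⟩) := by
  rw [strip, projIcc_of_mem]

/-- The part of the collar with angle in `(a, b)` and height in `(c, d)`. -/
def box (e : E) (a b c d : ℝ) : Set S := D.strip e '' (Ioo a b ×ˢ Ioo c d)

theorem isPathConnected_box (e : E) {a b c d : ℝ} (hab : a < b) (hcd : c < d) :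
    IsPathConnected (D.box e a b c d) :=
  (((convex_Ioo a b).prod (convex_Ioo c d)).isPathConnected
    ((nonempty_Ioo.2 hab).prod (nonempty_Ioo.2 hcd))).image (D.continuous_strip e)

theorem mem_box_iff (e : E) {a b c d : ℝ} (hc : 0 ≤ c) (hd : d ≤ 1) (p : Circle × unitInterval) :
    D.collar e p ∈ D.box e a b c d ↔
      (∃ θ ∈ Ioo a b, Circle.exp θ = p.1) ∧ (p.2 : ℝ) ∈ Ioo c d := by
  constructor
  · rintro ⟨⟨θ, t⟩, ⟨hθ, ht⟩, h⟩
    rw [D.strip_of_mem e θ ⟨hc.trans ht.1.le, ht.2.le.trans hd⟩] at h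
    have := (D.isEmbedding_collar e).injective h
    subst this
    exact ⟨⟨θ, hθ, rfl⟩, ht⟩
  · rintro ⟨⟨θ, hθ, h⟩, ht⟩
    refine ⟨(θ, p.2), ⟨hθ, ht⟩, ?_⟩
    rw [D.strip_of_mem e θ p.2.2, h]

theorem box_subset_openAnnulus (e : E) {a b c d : ℝ} (hc : 0 ≤ c) (hd : d ≤ 1) :
    D.box e a b c d ⊆ D.openAnnulus e := by
  rintro _ ⟨⟨θ, t⟩, ⟨hθ, ht⟩, rfl⟩
  rw [D.strip_of_mem e θ ⟨hc.trans ht.1.le, ht.2.le.trans hd⟩]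
  exact mem_image_of_mem _ ⟨hc.trans_lt ht.1, ht.2.trans_le hd⟩

theorem isOpen_box (e : E) (a b : ℝ) : IsOpen (D.box e a b 0 1) := by
  have : D.box e a b 0 1 = D.collar e '' ((Circle.exp '' Ioo a b) ×ˢ
      {t : unitInterval | 0 < (t : ℝ) ∧ (t : ℝ) < 1}) := by
    ext x
    constructor
    · intro hx
      obtain ⟨p, -, rfl⟩ := D.box_subset_openAnnulus e le_rfl le_rfl hx
      obtain ⟨h1, h2⟩ := (D.mem_box_iff e le_rfl le_rfl p).1 hx
      exact mem_image_of_mem _ ⟨h1, h2⟩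
    · rintro ⟨p, ⟨h1, h2⟩, rfl⟩
      exact (D.mem_box_iff e le_rfl le_rfl p).2 ⟨h1, h2⟩
  rw [this]
  refine D.isOpen_image_collar e ?_ fun p hp => hp.2
  refine (isLocalHomeomorph_circleExp.isOpenMap _ isOpen_Ioo).prod ?_
  exact (isOpen_lt continuous_const continuous_subtype_val).inter
    (isOpen_lt continuous_subtype_val continuous_const)

/-- A box of angular width `2π` is an annulus slit along a radius. After rotation by `-α` the
missing angle is the branch cut of `Complex.arg`, which thus gives a continuous inverse of the strip
coordinates on a convex rectangle. -/
theorem loopFinite_box (e : E) (α : ℝ) {Y : Set S} (A : Set S)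
    (hY : D.box e (α - Real.pi) (α + Real.pi) 0 1 ⊆ Y) :
    SingH.LoopFinite Y A (D.box e (α - Real.pi) (α + Real.pi) 0 1) := by
  let q : S → Circle × unitInterval := Function.invFun (D.collar e)
  have hq : ∀ p, q (D.collar e p) = p :=
    Function.leftInverse_invFun (D.isEmbedding_collar e).injective
  have hqc : ContinuousOn q (range (D.collar e)) := by
    rw [continuousOn_iff_continuous_domRestrict]
    have : (range (D.collar e)).domRestrict q = (D.isEmbedding_collar e).toHomeomorph.symm := by
      funext x
      obtain ⟨p, rfl⟩ := (D.isEmbedding_collar e).toHomeomorph.surjective x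
      rw [Homeomorph.symm_apply_apply]
      exact hq p
    rw [this]
    exact Homeomorph.continuous _
  let r : S → ℝ × ℝ := fun x =>
    (Complex.arg ((q x).1 * Circle.exp (-α) : Circle) + α, ((q x).2 : ℝ))
  have hr : ∀ θ t, θ ∈ Ioo (α - Real.pi) (α + Real.pi) → t ∈ Ioo (0 : ℝ) 1 →
      r (D.strip e (θ, t)) = (θ, t) := by
    intro θ t hθ ht
    rw [D.strip_of_mem e θ ⟨ht.1.le, ht.2.le⟩]
    simp only [r, hq]
    rw [← Circle.exp_add, Circle.arg_exp (by linarith [hθ.1]) (by linarith [hθ.2])]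
    simp
  refine SingH.LoopFinite.of_convex ((convex_Ioo (α - Real.pi) (α + Real.pi)).prod (convex_Ioo 0 1))
    (D.strip e) r (D.continuous_strip e).continuousOn (fun x hx => hY (mem_image_of_mem _ hx)) ?_ ?_ ?_
  · have hbox : D.box e (α - Real.pi) (α + Real.pi) 0 1 ⊆ range (D.collar e) :=
      (D.box_subset_openAnnulus e le_rfl le_rfl).trans (D.openAnnulus_subset_range e)
    have hqc' := hqc.mono hbox
    have h1 : ContinuousOn (fun x => (((q x).1 * Circle.exp (-α) : Circle) : ℂ))
        (D.box e (α - Real.pi) (α + Real.pi) 0 1) :=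
      continuous_subtype_val.comp_continuousOn
        ((continuous_fst.comp_continuousOn hqc').mul continuousOn_const)
    have h2 : ContinuousOn (fun x => Complex.arg ((q x).1 * Circle.exp (-α) : Circle))
        (D.box e (α - Real.pi) (α + Real.pi) 0 1) := by
      refine Complex.continuousOn_arg.comp h1 ?_
      rintro _ ⟨⟨θ, t⟩, ⟨hθ, ht⟩, rfl⟩
      have := congrArg Prod.fst (hr θ t hθ ht)
      simp only [r] at this
      rw [Complex.mem_slitPlane_iff_arg]
      refine ⟨?_, Circle.coe_ne_zero _⟩
      have h3 := hθ.2
      intro h4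
      rw [h4] at this
      simp only at h3
      linarith
    exact (h2.add continuousOn_const).prodMk
      (continuous_subtype_val.comp_continuousOn (continuous_snd.comp_continuousOn hqc'))
  · rintro _ ⟨⟨θ, t⟩, ⟨hθ, ht⟩, rfl⟩
    rw [hr θ t hθ ht]
    exact ⟨hθ, ht⟩
  · rintro _ ⟨⟨θ, t⟩, ⟨hθ, ht⟩, rfl⟩
    rw [hr θ t hθ ht]

end PinchedSurface

/-! ### Finite dimensionality of the relative homology of the pinched surface. -/

namespace PinchedSurface

variable {V E H : Type*} [Fintype V] [Fintype E] [Fintype H] {Γ : EnhancedLevelGraph V E H}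
  {S : Type*} [TopologicalSpace S] (D : PinchedSurface Γ S)

/-- The genus condition and stability make `finrank` positive, which excludes its default value `0`
in infinite dimension. -/
theorem finiteDimensional_H1_piece (v : V) :
    FiniteDimensional ℂ (SingH.H1 (D.piece v \ range D.mark) (∅ : Set S)) := by
  have h1 := D.genus_piece v
  have h2 := Γ.stable v
  refine Module.finite_of_finrank_pos ?_
  rw [EnhancedLevelGraph.valence] at h1
  omega

theorem finite_zeros : D.zeros.Finite := (toFinite _).image _

theorem finite_poles : D.poles.Finite := (toFinite _).image _

theorem poles_subset_range_mark : D.poles ⊆ range D.mark := image_subset_range _ _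

theorem mark_mem_poles_iff (h : H) : D.mark h ∈ D.poles ↔ Γ.order h < 0 :=
  D.mark_injective.mem_set_image

theorem mark_mem_zeros_iff (h : H) : D.mark h ∈ D.zeros ↔ 0 ≤ Γ.order h :=
  D.mark_injective.mem_set_image

theorem collar_notMem_range_mark (e : E) (p : Circle × unitInterval) :
    D.collar e p ∉ range D.mark := by
  rintro ⟨h, hh⟩
  exact D.mark_notMem_collar h e ⟨p, hh.symm⟩

theorem collar_notMem_poles (e : E) (p : Circle × unitInterval) : D.collar e p ∉ D.poles :=
  fun h => D.collar_notMem_range_mark e p (D.poles_subset_range_mark h)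

open scoped Classical in
-- Which piece contains a collar point depends only on whether its height is below or above `1 / 2`.
-- Both halves occur when the edge is a loop at `v`.
theorem piece_inter_box (v : V) (e : E) (a b : ℝ) :
    (D.piece v \ range D.mark) ∩ D.box e a b 0 1 =
      (if Γ.bot e = v then D.box e a b 0 (1 / 2) else ∅) ∪
        (if Γ.top e = v then D.box e a b (1 / 2) 1 else ∅) := by
  ext x
  by_cases hx : x ∈ range (D.collar e)
  · obtain ⟨p, rfl⟩ := hx
    have h1 := D.collar_notMem_range_mark e p
    have h2 := D.collar_mem_piece_iff e p v
    have h3 := D.mem_box_iff e (a := a) (b := b) le_rfl le_rfl p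
    have h4 := D.mem_box_iff e (a := a) (b := b) (c := 0) (d := 1 / 2) le_rfl (by norm_num) p
    have h5 := D.mem_box_iff e (a := a) (b := b) (c := 1 / 2) (d := 1) (by norm_num) le_rfl p
    simp only [mem_inter_iff, mem_sdiff, mem_union, h1, h2, h3]
    have h6 : ∀ (q : Prop) [Decidable q] (s : Set S),
        D.collar e p ∈ (if q then s else ∅) ↔ q ∧ D.collar e p ∈ s := by
      intro q _ s
      split_ifs with hq <;> simp [hq]
    rw [h6, h6, h4, h5]
    simp only [mem_Ioo]
    constructor
    · rintro ⟨⟨⟨h, h'⟩ | ⟨h, h'⟩, -⟩, h7, h8⟩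
      · exact Or.inl ⟨h, h7, h8.1, h'⟩
      · exact Or.inr ⟨h, h7, h', h8.2⟩
    · rintro (⟨h, h7, h8, h9⟩ | ⟨h, h7, h8, h9⟩)
      · exact ⟨⟨Or.inl ⟨h, h9⟩, not_false⟩, h7, h8, by linarith⟩
      · exact ⟨⟨Or.inr ⟨h, h8⟩, not_false⟩, h7, by linarith, h9⟩
  · have h1 : ∀ c d, 0 ≤ c → d ≤ 1 → x ∉ D.box e a b c d := fun c d hc hd h =>
      hx (D.openAnnulus_subset_range e (D.box_subset_openAnnulus e hc hd h))
    have h2 := h1 0 1 le_rfl le_rfl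
    have h3 := h1 0 (1 / 2) le_rfl (by norm_num)
    have h4 := h1 (1 / 2) 1 (by norm_num) le_rfl
    refine iff_of_false (fun h => h2 h.2) ?_
    rintro (h | h) <;> split_ifs at h <;> first | exact h3 h | exact h4 h | exact h

open scoped Classical in
theorem finJoined_piece_inter_box (v : V) (e : E) {a b : ℝ} (hab : a < b) :
    SingH.FinJoined ((D.piece v \ range D.mark) ∩ D.box e a b 0 1) := by
  rw [D.piece_inter_box]
  refine SingH.FinJoined.union ?_ ?_
  · split_ifs
    · exact (D.isPathConnected_box e hab (by norm_num)).finJoined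
    · exact SingH.finJoined_empty
  · split_ifs
    · exact (D.isPathConnected_box e hab (by norm_num)).finJoined
    · exact SingH.finJoined_empty

/-- Two boxes that cover an open annulus. -/
noncomputable def halfAnnulus (e : E) (s : Bool) : Set S :=
  D.box e ((if s then Real.pi else 0) - Real.pi) ((if s then Real.pi else 0) + Real.pi) 0 1

/-- The two boxes are the open annulus slit along the angle `π` and along the angle `0`, so they
overlap in two components. -/
theorem halfAnnulus_inter (e : E) :
    D.halfAnnulus e false ∩ D.halfAnnulus e true =
      D.box e 0 Real.pi 0 1 ∪ D.box e Real.pi (2 * Real.pi) 0 1 := by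
  have hpi := Real.pi_pos
  have hper : ∀ θ : ℝ, Circle.exp (θ - 2 * Real.pi) = Circle.exp θ := Circle.periodic_exp.sub_eq
  ext x
  by_cases hx : x ∈ range (D.collar e)
  · obtain ⟨p, rfl⟩ := hx
    have h3 := fun a b => D.mem_box_iff e (a := a) (b := b) le_rfl le_rfl p
    simp only [halfAnnulus, mem_inter_iff, mem_union, h3]
    simp only [Bool.false_eq_true, if_false, if_true, zero_sub, zero_add, sub_self]
    constructor
    · rintro ⟨⟨⟨θ, hθ, h⟩, ht⟩, ⟨⟨θ', hθ', h'⟩, -⟩⟩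
      rcases lt_trichotomy θ' Real.pi with h1 | h1 | h1
      · exact Or.inl ⟨⟨θ', ⟨hθ'.1, h1⟩, h'⟩, ht⟩
      · exfalso
        have h2 := Circle.arg_exp hθ.1 hθ.2.le
        rw [h, ← h', Circle.arg_exp (by linarith) h1.le] at h2
        linarith [hθ.2]
      · exact Or.inr ⟨⟨θ', ⟨h1, by linarith [hθ'.2]⟩, h'⟩, ht⟩
    · rintro (⟨⟨θ, hθ, h⟩, ht⟩ | ⟨⟨θ, hθ, h⟩, ht⟩)
      · exact ⟨⟨⟨θ, ⟨by linarith [hθ.1], hθ.2⟩, h⟩, ht⟩,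
          ⟨⟨θ, ⟨hθ.1, by linarith [hθ.2]⟩, h⟩, ht⟩⟩
      · exact ⟨⟨⟨θ - 2 * Real.pi, ⟨by linarith [hθ.1], by linarith [hθ.2]⟩, by rw [hper, h]⟩, ht⟩,
          ⟨⟨θ, ⟨by linarith [hθ.1], by linarith [hθ.2]⟩, h⟩, ht⟩⟩
  · have h1 : ∀ a b, x ∉ D.box e a b 0 1 := fun a b h =>
      hx (D.openAnnulus_subset_range e (D.box_subset_openAnnulus e le_rfl le_rfl h))
    simp [halfAnnulus, h1]

theorem halfAnnulus_subset_range (e : E) (s : Bool) : D.halfAnnulus e s ⊆ range (D.collar e) :=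
  (D.box_subset_openAnnulus e le_rfl le_rfl).trans (D.openAnnulus_subset_range e)

theorem isPathConnected_halfAnnulus (e : E) (s : Bool) : IsPathConnected (D.halfAnnulus e s) :=
  D.isPathConnected_box e (by linarith [Real.pi_pos]) (by norm_num)

theorem finJoined_halfAnnulus_inter (e e' : E) (s s' : Bool) :
    SingH.FinJoined (D.halfAnnulus e s ∩ D.halfAnnulus e' s') := by
  have hpi := Real.pi_pos
  by_cases h : e = e'
  · subst h
    have key : SingH.FinJoined (D.halfAnnulus e false ∩ D.halfAnnulus e true) := by
      rw [D.halfAnnulus_inter]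
      exact (D.isPathConnected_box e hpi (by norm_num)).finJoined.union
        (D.isPathConnected_box e (by linarith) (by norm_num)).finJoined
    cases s <;> cases s'
    · rw [inter_self]
      exact (D.isPathConnected_halfAnnulus e _).finJoined
    · exact key
    · rwa [inter_comm]
    · rw [inter_self]
      exact (D.isPathConnected_halfAnnulus e _).finJoined
  · rw [((D.disjoint_collar e e' h).mono (D.halfAnnulus_subset_range e s)
      (D.halfAnnulus_subset_range e' s')).inter_eq]
    exact SingH.finJoined_empty

theorem vanishingCycle_subset_halfAnnulus (e : E) :
    D.vanishingCycle e ⊆ D.halfAnnulus e false ∪ D.halfAnnulus e true := by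
  have hpi := Real.pi_pos
  rintro _ ⟨p, hp, rfl⟩
  have hp' : (p.2 : ℝ) ∈ Ioo (0 : ℝ) 1 := by
    change (p.2 : ℝ) = 1 / 2 at hp
    rw [hp]
    norm_num
  rcases (Complex.arg_le_pi p.1).lt_or_eq with h | h
  · exact Or.inl ((D.mem_box_iff e le_rfl le_rfl p).2 ⟨⟨Complex.arg p.1,
      ⟨by simpa using Complex.neg_pi_lt_arg p.1, by simpa using h⟩, Circle.exp_arg _⟩, hp'⟩)
  · refine Or.inr ((D.mem_box_iff e le_rfl le_rfl p).2 ⟨⟨Complex.arg p.1,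
      ⟨?_, ?_⟩, Circle.exp_arg _⟩, hp'⟩)
    · simp [h, hpi]
    · simp [h, hpi]

/-- The genus condition concerns pieces punctured at all marked points, so the marked zeros need
separate members of the cover. The discs are small enough to meet no collar and no second marked
point, so each meets only its own punctured piece, in a punctured disc. -/
theorem exists_zero_discs [T2Space S] [ChartedSpace ℂ S] :
    ∃ B : {h : H // 0 ≤ Γ.order h} → Set S, (∀ h, IsOpen (B h)) ∧ (∀ h, D.mark h ∈ B h) ∧
      (∀ h, B h ⊆ D.piece (Γ.vert h)) ∧ (∀ h k, k ≠ h.1 → D.mark k ∉ B h) ∧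
      (∀ h e, Disjoint (B h) (range (D.collar e))) ∧ (∀ h k, h ≠ k → Disjoint (B h) (B k)) ∧
      (∀ h, IsPathConnected (B h)) ∧ (∀ h, IsPathConnected (B h \ {D.mark h})) ∧
      ∀ h, ∀ Y A : Set S, B h ⊆ Y → SingH.LoopFinite Y A (B h) := by
  obtain ⟨U, hU, hUd⟩ := (finite_range D.mark).t2_separation
  have hcl : IsClosed (⋃ e, range (D.collar e)) := isClosed_iUnion_of_finite fun e =>
    (isCompact_range (D.isEmbedding_collar e).continuous).isClosed
  have hex : ∀ h : {h : H // 0 ≤ Γ.order h}, ∃ B : Set S, IsOpen B ∧ D.mark h ∈ B ∧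
      B ⊆ (U (D.mark h) ∩ D.piece (Γ.vert h)) \ (⋃ e, range (D.collar e)) ∧
      IsPathConnected B ∧ IsPathConnected (B \ {D.mark h}) ∧
      ∀ Y A : Set S, B ⊆ Y → SingH.LoopFinite Y A B := by
    intro h
    refine exists_disc ((((hU _).2).inter (D.isOpen_piece _)).sdiff hcl)
      ⟨⟨(hU _).1, D.mark_mem _⟩, ?_⟩
    rw [mem_iUnion, not_exists]
    exact D.mark_notMem_collar h
  choose B hB hmB hBs hBc hBc' hBl using hex
  have hdis : ∀ h k : H, k ≠ h → Disjoint (U (D.mark h)) (U (D.mark k)) := fun h k hk =>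
    hUd (mem_range_self h) (mem_range_self k) fun he => hk (D.mark_injective he.symm)
  refine ⟨B, hB, hmB, fun h x hx => (hBs h hx).1.2, fun h k hk hx => ?_, fun h e => ?_,
    fun h k hk => ?_, hBc, hBc', hBl⟩
  · exact Set.disjoint_left.1 (hdis h k hk) (hBs h hx).1.1 (hU _).1
  · exact Set.disjoint_left.2 fun x hx hxe => (hBs h hx).2 (mem_iUnion.2 ⟨e, hxe⟩)
  · exact (hdis h k fun he => hk (Subtype.ext he.symm)).mono (fun x hx => (hBs h hx).1.1)
      (fun x hx => (hBs k hx).1.1)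

theorem finiteDimensional_relH1 [T2Space S] [ChartedSpace ℂ S] : FiniteDimensional ℂ D.RelH1 := by
  obtain ⟨B, hB, hmB, hBp, hBm, hBe, hBd, hBc, hBc', hBl⟩ := D.exists_zero_discs
  have hpc : ∀ v, IsPathConnected (D.piece v \ range D.mark) := fun v =>
    (D.isPathConnected_piece v).sdiff_finite_of_surface (finite_range _) (D.isOpen_piece v)
  have hpP : ∀ v, D.piece v \ range D.mark ⊆ D.polesᶜ := fun v x hx hxP =>
    hx.2 (D.poles_subset_range_mark hxP)
  have haP : ∀ e s, D.halfAnnulus e s ⊆ D.polesᶜ := by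
    intro e s x hx
    obtain ⟨p, rfl⟩ := D.halfAnnulus_subset_range e s hx
    exact D.collar_notMem_poles e p
  have hBP : ∀ h, B h ⊆ D.polesᶜ := by
    rintro h x hx ⟨k, hk, rfl⟩
    refine hBm h k ?_ hx
    rintro rfl
    exact not_lt.2 h.2 hk
  have hpB : ∀ v h, SingH.FinJoined ((D.piece v \ range D.mark) ∩ B h) := by
    intro v h
    by_cases hv : Γ.vert h = v
    · have : (D.piece v \ range D.mark) ∩ B h = B h \ {D.mark h} := by
        ext x
        constructor
        · rintro ⟨⟨-, hx⟩, hxB⟩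
          exact ⟨hxB, fun hxm => hx ⟨h, hxm.symm⟩⟩
        · rintro ⟨hxB, hx⟩
          refine ⟨⟨hv ▸ hBp h hxB, ?_⟩, hxB⟩
          rintro ⟨k, rfl⟩
          by_cases hk : k = h
          · exact hx (hk ▸ rfl)
          · exact hBm h k hk hxB
      rw [this]
      exact (hBc' h).finJoined
    · rw [((D.disjoint_piece v _ (Ne.symm hv)).mono sdiff_subset (hBp h)).inter_eq]
      exact SingH.finJoined_empty
  have hpa : ∀ v e s, SingH.FinJoined ((D.piece v \ range D.mark) ∩ D.halfAnnulus e s) :=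
    fun v e s => D.finJoined_piece_inter_box v e (by linarith [Real.pi_pos])
  have haB : ∀ e s h, SingH.FinJoined (D.halfAnnulus e s ∩ B h) := by
    intro e s h
    rw [((hBe h e).symm.mono_left (D.halfAnnulus_subset_range e s)).inter_eq]
    exact SingH.finJoined_empty
  -- The punctured pieces miss the vanishing cycles and the marked zeros; the slit annuli and the
  -- discs fill these in.
  let O : V ⊕ (E × Bool) ⊕ {h : H // 0 ≤ Γ.order h} → Set S :=
    Sum.elim (fun v => D.piece v \ range D.mark) (Sum.elim (fun q => D.halfAnnulus q.1 q.2) B)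
  refine SingH.finiteDimensional_H1_of_cover D.finite_zeros O ?_ ?_ ?_ ?_ ?_ ?_
  · rintro (v | q | h)
    · exact (D.isOpen_piece v).sdiff (finite_range _).isClosed
    · exact D.isOpen_box _ _ _
    · exact hB h
  · rintro (v | q | h)
    · exact hpP v
    · exact haP _ _
    · exact hBP h
  · intro x hx
    by_cases hm : x ∈ range D.mark
    · obtain ⟨h, rfl⟩ := hm
      have : 0 ≤ Γ.order h := not_lt.1 fun hh => hx ((D.mark_mem_poles_iff h).2 hh)
      exact mem_iUnion.2 ⟨Sum.inr (Sum.inr ⟨h, this⟩), hmB ⟨h, this⟩⟩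
    · rcases D.mem_piece_or_vanishingCycle x with ⟨v, hv⟩ | ⟨e, he⟩
      · exact mem_iUnion.2 ⟨Sum.inl v, hv, hm⟩
      · rcases D.vanishingCycle_subset_halfAnnulus e he with h | h
        · exact mem_iUnion.2 ⟨Sum.inr (Sum.inl (e, false)), h⟩
        · exact mem_iUnion.2 ⟨Sum.inr (Sum.inl (e, true)), h⟩
  · rintro (v | q | h)
    · exact hpc v
    · exact D.isPathConnected_halfAnnulus _ _
    · exact hBc h
  · rintro (v | q | h)
    · have := D.finiteDimensional_H1_piece v
      exact SingH.LoopFinite.of_finiteDimensional (O := D.piece v \ range D.mark) (hpP v)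
    · exact D.loopFinite_box q.1 _ _ (haP q.1 q.2)
    · exact hBl h _ _ (hBP h)
  · rintro (v | q | h) (w | q' | k)
    · by_cases hvw : v = w
      · subst hvw
        change SingH.FinJoined ((D.piece v \ range D.mark) ∩ (D.piece v \ range D.mark))
        rw [inter_self]
        exact (hpc v).finJoined
      · change SingH.FinJoined ((D.piece v \ range D.mark) ∩ (D.piece w \ range D.mark))
        rw [((D.disjoint_piece v w hvw).mono sdiff_subset sdiff_subset).inter_eq]
        exact SingH.finJoined_empty
    · exact hpa v _ _
    · exact hpB v k
    · rw [inter_comm]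
      exact hpa w _ _
    · exact D.finJoined_halfAnnulus_inter _ _ _ _
    · exact haB _ _ k
    · rw [inter_comm]
      exact hpB w h
    · rw [inter_comm]
      exact haB _ _ h
    · by_cases hhk : h = k
      · subst hhk
        change SingH.FinJoined (B h ∩ B h)
        rw [inter_self]
        exact (hBc h).finJoined
      · change SingH.FinJoined (B h ∩ B k)
        rw [(hBd h k hhk).inter_eq]
        exact SingH.finJoined_empty

end PinchedSurface

/-! ### The degree condition and stability. -/

/-- A vertex without marked zeros has an edge to a lower level. -/
theorem EnhancedLevelGraph.exists_zero_or_descending_edge {V E H : Type*} [Fintype V] [Fintype E]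
    [Fintype H] (Γ : EnhancedLevelGraph V E H) (v : V) :
    (∃ h, Γ.vert h = v ∧ 0 ≤ Γ.order h) ∨
      ∃ e, Γ.top e = v ∧ Γ.level (Γ.bot e) < Γ.level v := by
  classical
  by_contra! hcon
  obtain ⟨h1, h2⟩ := hcon
  have hdeg := Γ.degree v
  have hst := Γ.stable v
  -- Every half-edge at `v` contributes at most `-1`: the legs are poles, the edges with upper end
  -- `v` are horizontal with `κ = 0`, and a lower end contributes `-κ - 1`. The sum `2g - 2` would
  -- be at most `-n`.
  have b1 : ∑ h with Γ.vert h = v, Γ.order h ≤ ∑ h with Γ.vert h = v, (-1 : ℤ) :=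
    Finset.sum_le_sum fun h hh => by
      have := h1 h (Finset.mem_filter.1 hh).2
      omega
  have b2 : ∑ e with Γ.top e = v, ((Γ.prongs e : ℤ) - 1) ≤ ∑ e with Γ.top e = v, (-1 : ℤ) :=
    Finset.sum_le_sum fun e he => by
      have hv := (Finset.mem_filter.1 he).2
      have h3 := h2 e hv
      have h4 := Γ.level_bot_le e
      have h5 := (Γ.prongs_eq_zero_iff e).2 (le_antisymm h4 (by rwa [hv]))
      rw [h5]
      simp
  have b3 : ∑ e with Γ.bot e = v, (-(Γ.prongs e : ℤ) - 1) ≤ ∑ e with Γ.bot e = v, (-1 : ℤ) :=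
    Finset.sum_le_sum fun e _ => by omega
  simp only [Finset.sum_const, nsmul_eq_mul] at b1 b2 b3
  zify at hst
  have hdeg' : (∑ h with Γ.vert h = v, Γ.order h) + (∑ e with Γ.top e = v, ((Γ.prongs e : ℤ) - 1))
    + (∑ e with Γ.bot e = v, (-(Γ.prongs e : ℤ) - 1)) = 2 * (Γ.genus v : ℤ) - 2 := by
    convert hdeg
  have hst' : (2 : ℤ) < 2 * Γ.genus v + (Finset.univ.filter fun h => Γ.vert h = v).card
    + (Finset.univ.filter fun e => Γ.top e = v).card
    + (Finset.univ.filter fun e => Γ.bot e = v).card := by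
    convert hst
  linarith

/-! ### Crossing numbers of paths and the dual cycles of the horizontal nodes. -/

namespace SingH

/-- A real lift starts and ends at integers. If these differed, the intermediate value theorem would
produce a point where the lift is a half-integer. -/
theorem increment_eq_zero_of_ne_half {X : Type*} [TopologicalSpace X]
    (g : C(X, AddCircle (1 : ℝ))) (σ : Simplex 1 X)
    (h : ∀ x, g (σ x) ≠ ((1 / 2 : ℝ) : AddCircle (1 : ℝ)))
    (h0 : g (σ (stdSimplex.vertex 0)) = 0) (h1 : g (σ (stdSimplex.vertex 1)) = 0) :
    increment g σ = 0 := by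
  obtain ⟨f, hf⟩ := exists_lift (g.comp σ)
  rw [increment_eq g σ f hf]
  have hint : ∀ x, g (σ x) = 0 → ∃ n : ℤ, (n : ℝ) = f x := by
    intro x hx
    have := hf x
    rw [ContinuousMap.comp_apply, hx, AddCircle.coe_eq_zero_iff] at this
    simpa using this
  have key : ∀ (n : ℤ) (x y), (n : ℝ) = f x → (n : ℝ) + 1 ≤ f y → False := by
    intro n x y hx hy
    obtain ⟨z, hz⟩ := mem_range_of_exists_le_of_exists_ge f.continuous
      (c := (n : ℝ) + 1 / 2) ⟨x, by linarith⟩ ⟨y, by linarith⟩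
    refine h z ?_
    have := hf z
    rw [ContinuousMap.comp_apply, hz] at this
    rw [← this, AddCircle.coe_add]
    have h2 : ((n : ℝ) : AddCircle (1 : ℝ)) = 0 := (AddCircle.coe_eq_zero_iff _).2 ⟨n, by simp⟩
    rw [h2, zero_add]
  obtain ⟨m, hm⟩ := hint _ h0
  obtain ⟨n, hn⟩ := hint _ h1
  rcases lt_trichotomy m n with hmn | rfl | hmn
  · refine (key m _ (stdSimplex.vertex 1) hm ?_).elim
    rw [← hn]
    exact_mod_cast hmn
  · rw [← hm, ← hn, sub_self]
  · refine (key n _ (stdSimplex.vertex 0) hn ?_).elim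
    rw [← hm]
    exact_mod_cast hmn

end SingH

namespace PinchedSurface

variable {V E H : Type*} [Fintype V] [Fintype E] [Fintype H] {Γ : EnhancedLevelGraph V E H}
  {S : Type*} [TopologicalSpace S] (D : PinchedSurface Γ S)

/-- On the open annulus the transverse coordinate lies in `[0, 1)`, where the projection to the
circle is injective; elsewhere the value is `0`. -/
theorem collapseFun_ne_half (e : E) {x : S} (hx : x ∉ D.vanishingCycle e) :
    D.collapseFun e x ≠ ((1 / 2 : ℝ) : AddCircle (1 : ℝ)) := by
  have hfact : Fact ((0 : ℝ) < 1) := ⟨one_pos⟩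
  have hmem : (1 / 2 : ℝ) ∈ Ico (0 : ℝ) (0 + 1) := by norm_num
  intro h
  by_cases hxa : x ∈ D.openAnnulus e
  · obtain ⟨p, hp, rfl⟩ := hxa
    rw [collapseFun_collar, AddCircle.coe_eq_coe_iff_of_mem_Ico (a := 0)
      ⟨hp.1.le, by simpa using hp.2⟩ hmem] at h
    exact hx (mem_image_of_mem _ h)
  · rw [D.collapseFun_of_notMem e hxa, ← AddCircle.coe_zero,
      AddCircle.coe_eq_coe_iff_of_mem_Ico (a := 0) (by simp) hmem] at h
    norm_num at h

/-! ### Pushing points out of an annulus -/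

open scoped Classical in
/-- The map that collapses the lower half of the annulus around `λ_e` onto its lower boundary circle
and stretches the upper half accordingly. -/
noncomputable def push (e : E) (x : S) : S :=
  if h : ∃ p, D.collar e p = x then
    D.collar e (h.choose.1, projIcc (0 : ℝ) 1 zero_le_one (2 * h.choose.2 - 1)) else x

theorem push_collar (e : E) (p : Circle × unitInterval) :
    D.push e (D.collar e p) =
      D.collar e (p.1, projIcc (0 : ℝ) 1 zero_le_one (2 * p.2 - 1)) := by
  have h : ∃ q, D.collar e q = D.collar e p := ⟨p, rfl⟩
  rw [push, dif_pos h, (D.isEmbedding_collar e).injective h.choose_spec]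

theorem push_collar_of_le (e : E) (p : Circle × unitInterval) (hp : (p.2 : ℝ) ≤ 1 / 2) :
    D.push e (D.collar e p) = D.collar e (p.1, 0) := by
  rw [push_collar, projIcc_of_le_left _ (by linarith)]
  rfl

theorem push_of_notMem (e : E) {x : S} (hx : x ∉ D.openAnnulus e) : D.push e x = x := by
  by_cases h : ∃ p, D.collar e p = x
  · obtain ⟨⟨z, t⟩, rfl⟩ := h
    rw [push_collar]
    rcases t.2.1.eq_or_lt with h0 | h0
    · have : t = 0 := Subtype.ext h0.symm
      subst this
      rw [projIcc_of_le_left _ (by simp)]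
      rfl
    rcases t.2.2.eq_or_lt with h1 | h1
    · have : t = 1 := Subtype.ext h1
      subst this
      rw [projIcc_of_right_le _ (by norm_num)]
      rfl
    · exact absurd ⟨(z, t), ⟨h0, h1⟩, rfl⟩ hx
  · rw [push, dif_neg h]

theorem continuous_push [T2Space S] (e : E) : Continuous (D.push e) := by
  have hcl : IsClosed (range (D.collar e)) :=
    (isCompact_range (D.isEmbedding_collar e).continuous).isClosed
  have h1 : ContinuousOn (D.push e) (range (D.collar e)) := by
    rw [continuousOn_iff_continuous_domRestrict]
    have hf : Continuous fun p : Circle × unitInterval => D.push e (D.collar e p) := by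
      simp only [push_collar]
      exact (D.isEmbedding_collar e).continuous.comp
        (continuous_fst.prodMk (continuous_projIcc.comp (by fun_prop)))
    have : (range (D.collar e)).domRestrict (D.push e) =
        (fun p => D.push e (D.collar e p)) ∘ (D.isEmbedding_collar e).toHomeomorph.symm := by
      funext x
      obtain ⟨p, rfl⟩ := (D.isEmbedding_collar e).toHomeomorph.surjective x
      rw [Function.comp_apply, Homeomorph.symm_apply_apply]
      rfl
    rw [this]
    exact hf.comp (Homeomorph.continuous _)
  have h2 : ContinuousOn (D.push e) (D.openAnnulus e)ᶜ :=
    continuousOn_id.congr fun x hx => D.push_of_notMem e hx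
  have h3 : range (D.collar e) ∪ (D.openAnnulus e)ᶜ = univ := by
    refine eq_univ_of_forall fun x => ?_
    by_cases hx : x ∈ D.openAnnulus e
    · exact Or.inl (D.openAnnulus_subset_range e hx)
    · exact Or.inr hx
  rw [← continuousOn_univ, ← h3]
  exact h1.union_of_isClosed h2 hcl (D.isOpen_collar e).isClosed_compl

theorem collar_zero_notMem_openAnnulus (e e' : E) (z : Circle) :
    D.collar e (z, 0) ∉ D.openAnnulus e' := by
  by_cases h : e = e'
  · subst h
    rintro ⟨p, hp, hpe⟩
    rw [(D.isEmbedding_collar e).injective hpe] at hp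
    exact lt_irrefl _ hp.1
  · exact fun hx => D.collar_notMem_range h _ (D.openAnnulus_subset_range e' hx)

theorem collar_one_notMem_openAnnulus (e e' : E) (z : Circle) :
    D.collar e (z, 1) ∉ D.openAnnulus e' := by
  by_cases h : e = e'
  · subst h
    rintro ⟨p, hp, hpe⟩
    rw [(D.isEmbedding_collar e).injective hpe] at hp
    exact lt_irrefl _ hp.2
  · exact fun hx => D.collar_notMem_range h _ (D.openAnnulus_subset_range e' hx)

/-- A piece without the poles and the annuli at some of its upper nodes is path connected. -/
theorem isPathConnected_piece_diff_annuli [T2Space S] [ChartedSpace ℂ S] (v : V) (T : Finset E)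
    (hT : ∀ e ∈ T, Γ.top e ≠ v) :
    IsPathConnected ((D.piece v \ D.poles) \ ⋃ e ∈ T, D.openAnnulus e) := by
  classical
  induction T using Finset.induction_on with
  | empty =>
    simpa using (D.isPathConnected_piece v).sdiff_finite_of_surface D.finite_poles (D.isOpen_piece v)
  | insert a T _ ih =>
    have ih := ih fun e he => hT e (Finset.mem_insert_of_mem he)
    -- As `v` is not the upper end of `a`, the piece meets this annulus at most in its lower half.
    -- `push` moves that half to the boundary circle of height `0` and fixes the rest, so
    -- connectedness passes to the image.
    have hpush : ((D.piece v \ D.poles) \ ⋃ e ∈ insert a T, D.openAnnulus e) =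
        D.push a '' ((D.piece v \ D.poles) \ ⋃ e ∈ T, D.openAnnulus e) := by
      ext x
      simp only [Finset.set_biUnion_insert, mem_sdiff, mem_union, not_or]
      constructor
      · rintro ⟨hx, hxa, hxT⟩
        exact ⟨x, ⟨hx, hxT⟩, D.push_of_notMem a hxa⟩
      · rintro ⟨x, ⟨hx, hxT⟩, rfl⟩
        by_cases hxa : x ∈ D.openAnnulus a
        · obtain ⟨p, -, rfl⟩ := D.openAnnulus_subset_range a hxa
          rcases (D.collar_mem_piece_iff a p v).1 hx.1 with ⟨hv, hp⟩ | ⟨hv, -⟩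
          · rw [D.push_collar_of_le a p hp.le]
            refine ⟨⟨?_, D.collar_notMem_poles _ _⟩, D.collar_zero_notMem_openAnnulus _ _ _, ?_⟩
            · exact (D.collar_mem_piece_iff a _ v).2 (Or.inl ⟨hv, by simp⟩)
            · simp only [mem_iUnion, not_exists]
              exact fun e _ => D.collar_zero_notMem_openAnnulus _ _ _
          · exact absurd hv (hT a (Finset.mem_insert_self _ _))
        · rw [D.push_of_notMem a hxa]
          exact ⟨hx, hxa, hxT⟩
    rw [hpush]
    exact ih.image (D.continuous_push a)

/-! ### Paths in the subsurfaces of bounded level -/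

theorem mem_surfaceLE_of_mem_piece {i : ℤ} {v : V} {x : S} (hv : Γ.level v ≤ i)
    (hx : x ∈ D.piece v) (h : ∀ e, i < Γ.level (Γ.top e) → x ∉ D.openAnnulus e) :
    x ∈ D.surfaceLE i := by
  refine ⟨Or.inl (mem_iUnion₂.2 ⟨v, hv, hx⟩), ?_⟩
  simp only [mem_iUnion, not_exists]
  exact fun e he => h e he.2

theorem collar_mem_surfaceLE {i : ℤ} {e : E} (he : Γ.level (Γ.top e) ≤ i)
    (p : Circle × unitInterval) : D.collar e p ∈ D.surfaceLE i := by
  refine ⟨?_, ?_⟩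
  · rcases lt_trichotomy (p.2 : ℝ) (1 / 2) with hp | hp | hp
    · exact Or.inl (mem_iUnion₂.2 ⟨_, (Γ.level_bot_le e).trans he, D.collar_mem_bot e p hp⟩)
    · exact Or.inr (mem_iUnion₂.2 ⟨e, he, mem_image_of_mem _ hp⟩)
    · exact Or.inl (mem_iUnion₂.2 ⟨_, he, D.collar_mem_top e p hp⟩)
  · simp only [mem_iUnion, not_exists]
    intro e' he' hx
    refine D.collar_notMem_range ?_ p (D.openAnnulus_subset_range e' hx)
    rintro rfl
    exact not_lt.2 he he'.2

/-- The surface of level at most `i` without the poles and the horizontal vanishing cycles. -/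
def cutSurface (i : ℤ) : Set S :=
  {x | x ∈ D.surfaceLE i ∧ x ∉ D.poles ∧ ∀ e, Γ.IsHorizontal e → x ∉ D.vanishingCycle e}

/-- The annuli removed from the subsurface belong to edges with upper end above level `i`, hence
never with upper end `v`, so the piece stays connected without them. Inside a piece no vanishing
cycle is met. -/
theorem joinedIn_cutSurface_of_mem_piece [T2Space S] [ChartedSpace ℂ S] {i : ℤ} {v : V}
    (hv : Γ.level v ≤ i) {x y : S} (hx : x ∈ D.piece v) (hy : y ∈ D.piece v)
    (hxi : x ∈ D.surfaceLE i) (hyi : y ∈ D.surfaceLE i) (hxP : x ∉ D.poles) (hyP : y ∉ D.poles) :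
    JoinedIn (D.cutSurface i) x y := by
  classical
  let T : Finset E := Finset.univ.filter fun e =>
    Γ.level (Γ.bot e) ≤ i ∧ i < Γ.level (Γ.top e)
  have hT : ∀ z ∈ D.surfaceLE i, z ∉ ⋃ e ∈ T, D.openAnnulus e := by
    intro z hz h
    obtain ⟨e, he, hze⟩ := mem_iUnion₂.1 h
    exact hz.2 (mem_iUnion₂.2 ⟨e, (Finset.mem_filter.1 he).2, hze⟩)
  have hc := D.isPathConnected_piece_diff_annuli v T (by
    rintro e he rfl
    exact not_lt.2 hv (Finset.mem_filter.1 he).2.2)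
  refine (hc.joinedIn x ⟨⟨hx, hxP⟩, hT x hxi⟩ y ⟨⟨hy, hyP⟩, hT y hyi⟩).mono ?_
  rintro z ⟨⟨hz, hzP⟩, hzT⟩
  refine ⟨D.mem_surfaceLE_of_mem_piece hv hz fun e he hze => ?_, hzP, fun e _ hze =>
    Set.disjoint_left.1 (D.vanishingCycle_disjoint_piece e v) hze hz⟩
  -- An edge with both ends above level `i` is not in `T`, but its annulus does not meet the piece
  -- of `v`.
  by_cases hb : Γ.level (Γ.bot e) ≤ i
  · exact hzT (mem_iUnion₂.2 ⟨e, Finset.mem_filter.2 ⟨Finset.mem_univ e, hb, he⟩, hze⟩)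
  · obtain ⟨p, -, rfl⟩ := D.openAnnulus_subset_range e hze
    rcases (D.collar_mem_piece_iff e p v).1 hz with ⟨rfl, -⟩ | ⟨rfl, -⟩
    · exact hb hv
    · exact not_lt.2 hv he

/-- The path is a radial segment of the collar. It meets no other collar, and the vanishing cycle it
does cross is vertical. -/
theorem joinedIn_cutSurface_collar {i : ℤ} {e : E} (he : Γ.level (Γ.top e) ≤ i)
    (hv : ¬ Γ.IsHorizontal e) : JoinedIn (D.cutSurface i) (D.collar e (1, 1)) (D.collar e (1, 0)) := by
  have : PathConnectedSpace unitInterval := isPathConnected_iff_pathConnectedSpace.1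
    ((convex_Icc (0 : ℝ) 1).isPathConnected (nonempty_Icc.2 zero_le_one))
  have hpc : IsPathConnected (range fun t : unitInterval => D.collar e (1, t)) :=
    isPathConnected_range
      ((D.isEmbedding_collar e).continuous.comp (continuous_const.prodMk continuous_id))
  refine (hpc.joinedIn _ (mem_range_self 1) _ (mem_range_self 0)).mono ?_
  rintro _ ⟨t, rfl⟩
  refine ⟨D.collar_mem_surfaceLE he _, D.collar_notMem_poles e _, fun e' he' hx => ?_⟩
  refine D.collar_notMem_range ?_ _
    (D.openAnnulus_subset_range e' (D.vanishingCycle_subset_openAnnulus e' hx))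
  rintro rfl
  exact hv he'

theorem mark_mem_surfaceLE {i : ℤ} (h : H) (hi : Γ.level (Γ.vert h) ≤ i) :
    D.mark h ∈ D.surfaceLE i :=
  D.mem_surfaceLE_of_mem_piece hi (D.mark_mem h) fun e _ he =>
    D.mark_notMem_collar h e (D.openAnnulus_subset_range e he)

/-- Every point of level at most `i` can be joined to a marked zero by a path that descends through
vertical nodes only. -/
theorem exists_joinedIn_zero [T2Space S] [ChartedSpace ℂ S] {i : ℤ} (v : V) (hv : Γ.level v ≤ i)
    {x : S} (hx : x ∈ D.piece v) (hxi : x ∈ D.surfaceLE i) (hxP : x ∉ D.poles) :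
    ∃ h, 0 ≤ Γ.order h ∧ D.mark h ∈ D.surfaceLE i ∧
      JoinedIn (D.cutSurface i) x (D.mark h) := by
  -- The induction is on the height of `v` above the lowest level, which drops along a descending
  -- edge.
  induction hn : (Γ.level v + Γ.depth).toNat using Nat.strong_induction_on generalizing v x with
  | _ n ih =>
    rcases Γ.exists_zero_or_descending_edge v with ⟨h, rfl, hh⟩ | ⟨e, rfl, he⟩
    · have hm := D.mark_mem_surfaceLE h hv
      exact ⟨h, hh, hm, D.joinedIn_cutSurface_of_mem_piece hv hx (D.mark_mem h) hxi hm hxP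
        fun hP => not_lt.2 hh ((D.mark_mem_poles_iff h).1 hP)⟩
    · have h1 := D.joinedIn_cutSurface_of_mem_piece hv hx
        (D.collar_mem_top e (1, 1) (by norm_num)) hxi (D.collar_mem_surfaceLE hv _) hxP
        (D.collar_notMem_poles e _)
      have h2 := D.joinedIn_cutSurface_collar hv (fun hh => he.ne hh)
      have h3 := (Γ.level_mem (Γ.bot e)).1
      obtain ⟨h, hh, hm, hj⟩ := ih _ (by omega) (Γ.bot e) (he.le.trans hv)
        (D.collar_mem_bot e (1, 0) (by norm_num)) (D.collar_mem_surfaceLE hv _)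
        (D.collar_notMem_poles e _) rfl
      exact ⟨h, hh, hm, h1.trans (h2.trans hj)⟩

/-- The path across the annulus around `λ_e`. -/
noncomputable def transversal (e : E) : SingH.Simplex 1 S where
  toFun x := D.collar e (1, ⟨x 1, x.2.1 1, stdSimplex.le_one x 1⟩)
  continuous_toFun := (D.isEmbedding_collar e).continuous.comp (continuous_const.prodMk
    (((continuous_apply 1).comp continuous_subtype_val).subtype_mk _))

theorem transversal_vertex_zero (e : E) :
    D.transversal e (stdSimplex.vertex 0) = D.collar e (1, 0) := by
  change D.collar e _ = _
  congr

theorem transversal_vertex_one (e : E) :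
    D.transversal e (stdSimplex.vertex 1) = D.collar e (1, 1) := by
  change D.collar e _ = _
  congr

theorem increment_transversal [T2Space S] (e : E) :
    SingH.increment ⟨D.collapseFun e, D.continuous_collapseFun e⟩ (D.transversal e) = 1 := by
  rw [SingH.increment_eq _ _
    (⟨fun x => x 1, (continuous_apply 1).comp continuous_subtype_val⟩ :
      C(stdSimplex ℝ (Fin 2), ℝ))]
  · change (stdSimplex.vertex (S := ℝ) (1 : Fin 2)) 1 - (stdSimplex.vertex (S := ℝ) (0 : Fin 2)) 1 = 1
    simp
  · intro x
    exact (D.collapseFun_collar e (1, ⟨x 1, x.2.1 1, stdSimplex.le_one x 1⟩)).symm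

theorem increment_transversal_of_ne [T2Space S] {e e' : E} (h : e ≠ e') :
    SingH.increment ⟨D.collapseFun e', D.continuous_collapseFun e'⟩ (D.transversal e) = 0 := by
  rw [SingH.increment_eq _ _ 0]
  · simp
  · intro x
    change ((0 : ℝ) : AddCircle (1 : ℝ)) = D.collapseFun e' (D.collar e _)
    rw [D.collapseFun_of_notMem e' fun hx => D.collar_notMem_range h _
      (D.openAnnulus_subset_range e' hx), AddCircle.coe_zero]

/-- Every horizontal vanishing cycle is crossed once by a relative cycle of the same level that
crosses no other horizontal vanishing cycle. -/
theorem exists_crossing_cycle [T2Space S] [ChartedSpace ℂ S] {i : ℤ} (e : Γ.HorEdge i) :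
    ∃ c ∈ D.W i, D.inter e.1 c = 1 ∧
      ∀ e', Γ.IsHorizontal e' → e' ≠ e.1 → D.inter e' c = 0 := by
  obtain ⟨e, hor, hi⟩ := e
  have hbot : Γ.level (Γ.bot e) ≤ i := (Γ.level_bot_le e).trans hi.le
  obtain ⟨h₁, hh₁, hm₁, hj₁⟩ := D.exists_joinedIn_zero (Γ.bot e) hbot
    (D.collar_mem_bot e (1, 0) (by norm_num)) (D.collar_mem_surfaceLE hi.le _)
    (D.collar_notMem_poles e _)
  obtain ⟨h₂, hh₂, hm₂, hj₂⟩ := D.exists_joinedIn_zero (Γ.top e) hi.le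
    (D.collar_mem_top e (1, 1) (by norm_num)) (D.collar_mem_surfaceLE hi.le _)
    (D.collar_notMem_poles e _)
  obtain ⟨σ, hσ, hσ0, hσ1⟩ := SingH.exists_path_of_joinedIn hj₁.symm
  obtain ⟨τ, hτ, hτ0, hτ1⟩ := SingH.exists_path_of_joinedIn hj₂
  let Y : Set S := D.surfaceLE i \ D.poles
  have hcut : D.cutSurface i ⊆ Y := fun x hx => ⟨hx.1, hx.2.1⟩
  have hzY : ∀ h, 0 ≤ Γ.order h → D.mark h ∈ D.surfaceLE i → D.mark h ∈ D.zeros ∩ Y :=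
    fun h hh hm => ⟨(D.mark_mem_zeros_iff h).2 hh, hm,
      fun hP => not_lt.2 hh ((D.mark_mem_poles_iff h).1 hP)⟩
  -- From a marked zero up to the `bot` side of `λ_e`, once across the annulus, and from the `top`
  -- side down to a marked zero. The two zeros may coincide.
  let c : SingH.Chain 1 S := Finsupp.single σ 1 + Finsupp.single (D.transversal e) 1 +
    Finsupp.single τ 1
  have hc : c ∈ SingH.relCycles Y D.zeros := by
    refine ⟨?_, ?_⟩
    · refine Submodule.add_mem _ (Submodule.add_mem _ ?_ ?_) ?_
      · exact Finsupp.single_mem_supported ℂ _ (hσ.trans hcut)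
      · refine Finsupp.single_mem_supported ℂ _ ?_
        rintro _ ⟨x, rfl⟩
        exact ⟨D.collar_mem_surfaceLE hi.le _, D.collar_notMem_poles e _⟩
      · exact Finsupp.single_mem_supported ℂ _ (hτ.trans hcut)
    · change SingH.boundary 0 c ∈ SingH.chainsIn 0 (D.zeros ∩ Y)
      have : SingH.boundary 0 c = Finsupp.single (SingH.point (D.mark h₂)) 1
          - Finsupp.single (SingH.point (D.mark h₁)) 1 := by
        simp only [c, map_add, SingH.boundary_single_path]
        rw [hσ0, hσ1, hτ0, hτ1, D.transversal_vertex_zero, D.transversal_vertex_one]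
        abel
      rw [this]
      refine Submodule.sub_mem _ (Finsupp.single_mem_supported ℂ _ ?_)
        (Finsupp.single_mem_supported ℂ _ ?_)
      · rintro _ ⟨x, rfl⟩
        exact hzY h₂ hh₂ hm₂
      · rintro _ ⟨x, rfl⟩
        exact hzY h₁ hh₁ hm₁
  have hinter : ∀ e', D.inter e' (SingH.inclMap (Y := Y) (Y' := D.polesᶜ) D.zeros
      (fun _ hx => hx.2) (Submodule.Quotient.mk ⟨c, hc⟩)) =
      (SingH.increment ⟨D.collapseFun e', D.continuous_collapseFun e'⟩ σ : ℂ) +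
        (SingH.increment ⟨D.collapseFun e', D.continuous_collapseFun e'⟩ (D.transversal e) : ℂ) +
        (SingH.increment ⟨D.collapseFun e', D.continuous_collapseFun e'⟩ τ : ℂ) := by
    intro e'
    change SingH.chainWinding _ c = _
    simp only [c, map_add, SingH.chainWinding, Finsupp.linearCombination_single, one_smul]
  have hzero : ∀ h, 0 ≤ Γ.order h → ∀ e', D.collapseFun e' (D.mark h) = 0 :=
    fun h hh e' => D.collapseFun_zeros e' _ ((D.mark_mem_zeros_iff h).2 hh)
  -- `σ` and `τ` avoid all horizontal vanishing cycles, and each joins a marked zero to a collar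
  -- boundary, both over the base point. Only the transversal contributes.
  have hσz : ∀ e', Γ.IsHorizontal e' →
      SingH.increment ⟨D.collapseFun e', D.continuous_collapseFun e'⟩ σ = 0 := by
    intro e' he'
    refine SingH.increment_eq_zero_of_ne_half _ _ (fun x => ?_) ?_ ?_
    · exact D.collapseFun_ne_half e' ((hσ (mem_range_self x)).2.2 e' he')
    · rw [hσ0]
      exact hzero h₁ hh₁ e'
    · rw [hσ1]
      exact D.collapseFun_of_notMem e' (D.collar_zero_notMem_openAnnulus _ _ _)
  have hτz : ∀ e', Γ.IsHorizontal e' →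
      SingH.increment ⟨D.collapseFun e', D.continuous_collapseFun e'⟩ τ = 0 := by
    intro e' he'
    refine SingH.increment_eq_zero_of_ne_half _ _ (fun x => ?_) ?_ ?_
    · exact D.collapseFun_ne_half e' ((hτ (mem_range_self x)).2.2 e' he')
    · rw [hτ0]
      exact D.collapseFun_of_notMem e' (D.collar_one_notMem_openAnnulus _ _ _)
    · rw [hτ1]
      exact hzero h₂ hh₂ e'
  refine ⟨_, ⟨Submodule.Quotient.mk ⟨c, hc⟩, rfl⟩, ?_, fun e' he' hne => ?_⟩
  · rw [hinter, hσz e hor, hτz e hor, D.increment_transversal]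
    simp
  · rw [hinter, hσz e' he', hτz e' he', D.increment_transversal_of_ne hne.symm]
    simp

end PinchedSurface

theorem SingH.inclMap_inclMap {X : Type*} [TopologicalSpace X] {Y Y' Y'' : Set X} (A : Set X)
    (h : Y ⊆ Y') (h' : Y' ⊆ Y'') (m : SingH.H1 Y A) :
    SingH.inclMap A h' (SingH.inclMap A h m) = SingH.inclMap A (h.trans h') m := by
  obtain ⟨c, rfl⟩ := Submodule.Quotient.mk_surjective _ m
  rfl

theorem SingH.inclMap_refl {X : Type*} [TopologicalSpace X] {Y : Set X} (A : Set X)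
    (h : Y ⊆ Y) (m : SingH.H1 Y A) : SingH.inclMap A h m = m := by
  obtain ⟨c, rfl⟩ := Submodule.Quotient.mk_surjective _ m
  rfl

namespace PinchedSurface

/-! ### Bases adapted to a filtration. -/

section LinearAlgebra

variable {M : Type*} [AddCommGroup M] [Module ℂ M]

theorem mapsIsoOnto_of_disjoint {T A B : Submodule ℂ M} (h : Disjoint T B) (hA : T ⊔ B = A) :
    MapsIsoOnto T A B := by
  refine ⟨?_, ?_⟩
  · rw [← LinearMap.ker_eq_bot, LinearMap.ker_eq_bot']
    rintro ⟨m, hm⟩ h0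
    have : B.mkQ m = 0 := h0
    rw [Submodule.mkQ_apply, Submodule.Quotient.mk_eq_zero] at this
    exact Subtype.ext (Submodule.disjoint_def.1 h m hm this)
  · rw [← hA, Submodule.map_sup, Submodule.mkQ_map_self, sup_bot_eq,
      LinearMap.domRestrict, LinearMap.range_comp, Submodule.range_subtype]

/-- Intersect a complement of `B` with `A` and apply the modular law. -/
theorem exists_relative_complement {A B : Submodule ℂ M} (h : B ≤ A) :
    ∃ C : Submodule ℂ M, Disjoint C B ∧ C ⊔ B = A := by
  obtain ⟨C, hC⟩ := B.exists_isCompl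
  refine ⟨C ⊓ A, hC.symm.disjoint.mono_left inf_le_left, ?_⟩
  rw [sup_comm, ← sup_inf_assoc_of_le C h, hC.sup_eq_top, top_inf_eq]

/-- A family that is compatible with the level filtration in each degree is linearly independent and
spans the steps of the filtration. -/
theorem linearIndepOn_and_span_eq {N : ℕ} {W : ℤ → Submodule ℂ M}
    (hbot : ∀ i < -(N : ℤ), W i = ⊥) (htop : ∀ i, 0 ≤ i → W i = ⊤)
    {κ : Icc (-(N : ℤ)) 0 → Type*} (β : (Σ i, κ i) → M)
    (hli : ∀ i, LinearIndependent ℂ fun k => β ⟨i, k⟩)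
    (hdis : ∀ i : Icc (-(N : ℤ)) 0,
      Disjoint (W (i - 1)) (Submodule.span ℂ (range fun k => β ⟨i, k⟩)))
    (hsup : ∀ i : Icc (-(N : ℤ)) 0,
      W (i - 1) ⊔ Submodule.span ℂ (range fun k => β ⟨i, k⟩) = W i)
    (m : ℤ) (hm : -(N : ℤ) - 1 ≤ m) :
    LinearIndepOn ℂ β {x | (x.1 : ℤ) ≤ m} ∧
      Submodule.span ℂ (β '' {x | (x.1 : ℤ) ≤ m}) = W m := by
  induction m, hm using Int.leInduction with
  | base =>
    -- The induction starts one step below the lowest level, where the family and the filtration are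
    -- both trivial.
    have : {x : Σ i, κ i | (x.1 : ℤ) ≤ -(N : ℤ) - 1} = ∅ := by
      refine eq_empty_of_forall_notMem fun x hx => ?_
      have h1 : (x.1 : ℤ) ≤ -(N : ℤ) - 1 := hx
      have h2 := x.1.2.1
      omega
    rw [this, image_empty, Submodule.span_empty, hbot _ (by omega)]
    exact ⟨linearIndepOn_empty ℂ β, rfl⟩
  | succ m hm ih =>
    by_cases hm0 : m + 1 ≤ 0
    · let i : Icc (-(N : ℤ)) 0 := ⟨m + 1, by omega, hm0⟩
      have hset : {x : Σ i, κ i | (x.1 : ℤ) ≤ m + 1} =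
          {x | (x.1 : ℤ) ≤ m} ∪ range (Sigma.mk i) := by
        ext ⟨j, k⟩
        constructor
        · intro hj
          have hj' : (j : ℤ) ≤ m + 1 := hj
          rcases hj'.lt_or_eq with h | h
          · exact Or.inl (Int.lt_add_one_iff.1 h)
          · obtain rfl : j = i := Subtype.ext h
            exact Or.inr ⟨k, rfl⟩
        · rintro (h | ⟨k', h⟩)
          · have h' : (j : ℤ) ≤ m := h
            change (j : ℤ) ≤ m + 1
            omega
          · have : i = j := congrArg Sigma.fst h
            subst this
            exact le_refl (m + 1)
      have himg : β '' range (Sigma.mk i) = range fun k => β ⟨i, k⟩ := by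
        rw [← range_comp]
        rfl
      have hi : (i : ℤ) - 1 = m := by
        change m + 1 - 1 = m
        omega
      have h1 := hdis i
      have h2 := hsup i
      rw [hi] at h1 h2
      rw [hset]
      refine ⟨ih.1.union ?_ ?_, ?_⟩
      · exact (linearIndepOn_range_iff sigma_mk_injective β).2 (hli i)
      · rw [ih.2, himg]
        exact h1
      · rw [image_union, Submodule.span_union, ih.2, himg]
        exact h2
    -- Above level `0` neither the family nor the filtration changes any more.
    · have hset : {x : Σ i, κ i | (x.1 : ℤ) ≤ m + 1} = {x | (x.1 : ℤ) ≤ m} := by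
        ext x
        have := x.1.2.2
        constructor
        · intro _
          change (x.1 : ℤ) ≤ m
          omega
        · intro _
          change (x.1 : ℤ) ≤ m + 1
          omega
      rw [hset, htop (m + 1) (by omega), ← htop m (by omega)]
      exact ih

/-- A filtration with an intermediate filtration `U` and given complements of `U i` in `W i` has an
adapted basis. -/
theorem exists_graded_basis [FiniteDimensional ℂ M] {N : ℕ} {W U : ℤ → Submodule ℂ M}
    (hbot : ∀ i < -(N : ℤ), W i = ⊥) (htop : ∀ i, 0 ≤ i → W i = ⊤) (hWU : ∀ i, W (i - 1) ≤ U i)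
    {κ : Icc (-(N : ℤ)) 0 → Type*} (δ : ∀ i, κ i → M) (hδ : ∀ i, LinearIndependent ℂ (δ i))
    (hdis : ∀ i : Icc (-(N : ℤ)) 0, Disjoint (Submodule.span ℂ (range (δ i))) (U i))
    (hsup : ∀ i : Icc (-(N : ℤ)) 0, Submodule.span ℂ (range (δ i)) ⊔ U i = W i) :
    ∃ (n : Icc (-(N : ℤ)) 0 → ℕ) (b : Module.Basis (Σ i, Fin (n i) ⊕ κ i) ℂ M),
      (∀ i e, b ⟨i, Sum.inr e⟩ = δ i e) ∧
      (∀ i : Icc (-(N : ℤ)) 0,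
        Disjoint (Submodule.span ℂ (range fun k => b ⟨i, Sum.inl k⟩)) (W (i - 1))) ∧
      (∀ i : Icc (-(N : ℤ)) 0,
        Submodule.span ℂ (range fun k => b ⟨i, Sum.inl k⟩) ⊔ W (i - 1) = U i) ∧
      ∀ i : Icc (-(N : ℤ)) 0, W i = Submodule.span ℂ (b '' {x | x.1 ≤ i}) := by
  choose C hCdis hCsup using fun i : Icc (-(N : ℤ)) 0 => exists_relative_complement (hWU i)
  let n : Icc (-(N : ℤ)) 0 → ℕ := fun i => Module.finrank ℂ (C i)
  let a : ∀ i, Module.Basis (Fin (n i)) ℂ (C i) := fun i => Module.finBasis ℂ (C i)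
  let β : (Σ i, Fin (n i) ⊕ κ i) → M := fun x =>
    Sum.elim (fun k => (a x.1 k : M)) (δ x.1) x.2
  have haspan : ∀ i, Submodule.span ℂ (range fun k => (a i k : M)) = C i := by
    intro i
    have h1 := congrArg (Submodule.map (C i).subtype) (a i).span_eq
    rw [Submodule.map_span, ← range_comp, Submodule.map_subtype_top] at h1
    exact h1
  have hspan : ∀ i, Submodule.span ℂ (range fun k => β ⟨i, k⟩) =
      C i ⊔ Submodule.span ℂ (range (δ i)) := by
    intro i
    change Submodule.span ℂ (range (Sum.elim (fun k => (a i k : M)) (δ i))) = _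
    rw [Sum.elim_range, Submodule.span_union, haspan]
  have hCU : ∀ i : Icc (-(N : ℤ)) 0, C i ≤ U i := fun i => le_sup_left.trans (hCsup i).le
  have hli : ∀ i, LinearIndependent ℂ fun k => β ⟨i, k⟩ := by
    intro i
    have h1 : LinearIndependent ℂ fun k => (a i k : M) :=
      (a i).linearIndependent.map' (C i).subtype (Submodule.ker_subtype _)
    have h2 := h1.sum_type (hδ i) (by
      rw [haspan]
      exact ((hdis i).mono_right (hCU i)).symm)
    convert h2 using 1
  have hmain := linearIndepOn_and_span_eq hbot htop β hli
    (fun i => by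
      rw [hspan]
      -- `C i` is disjoint from `W (i - 1)`, and their sum `U i` is disjoint from the span of `δ i`.
      refine Disjoint.disjoint_sup_right_of_disjoint_sup_left (hCdis i).symm ?_
      rw [sup_comm, hCsup]
      exact (hdis i).symm)
    (fun i => by
      rw [hspan, ← sup_assoc, sup_comm _ (C i), hCsup, sup_comm, hsup])
  have huniv : {x : Σ i, Fin (n i) ⊕ κ i | (x.1 : ℤ) ≤ 0} = univ :=
    eq_univ_of_forall fun x => x.1.2.2
  obtain ⟨h0li, h0span⟩ := hmain 0 (by omega)
  rw [huniv] at h0li h0span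
  rw [image_univ, htop 0 le_rfl] at h0span
  have hb : ⇑(Module.Basis.mk (linearIndepOn_univ_iff.1 h0li) h0span.ge) = β := Module.Basis.coe_mk _ _
  refine ⟨n, Module.Basis.mk (linearIndepOn_univ_iff.1 h0li) h0span.ge, ?_, ?_, ?_, ?_⟩
  · intro i e
    rw [hb]
    rfl
  · intro i
    simp only [hb]
    change Disjoint (Submodule.span ℂ (range fun k => (a i k : M))) _
    rw [haspan]
    exact hCdis i
  · intro i
    simp only [hb]
    change Submodule.span ℂ (range fun k => (a i k : M)) ⊔ _ = _
    rw [haspan]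
    exact hCsup i
  · intro i
    rw [hb]
    exact (hmain i (by have := i.2.1; omega)).2.symm

end LinearAlgebra

/-! ### The level and vertical filtrations. -/

variable {V E H : Type*} [Fintype V] [Fintype E] [Fintype H] {Γ : EnhancedLevelGraph V E H}
  {S : Type*} [TopologicalSpace S] (D : PinchedSurface Γ S)

/-- The annuli removed at level `j` must not cut into the smaller subsurface. Such an annulus is
either already removed at level `i`, or both ends of its edge lie above `i` and it misses that
subsurface. -/
theorem surfaceLE_mono {i j : ℤ} (hij : i ≤ j) : D.surfaceLE i ⊆ D.surfaceLE j := by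
  rintro x ⟨hx, hxi⟩
  have hx' : (∃ v, Γ.level v ≤ i ∧ x ∈ D.piece v) ∨
      ∃ e, Γ.level (Γ.top e) ≤ i ∧ x ∈ D.vanishingCycle e := by
    simpa using hx
  refine ⟨?_, fun hxj => ?_⟩
  · rcases hx' with ⟨v, hv, hxv⟩ | ⟨e, he, hxe⟩
    · exact Or.inl (mem_iUnion₂.2 ⟨v, hv.trans hij, hxv⟩)
    · exact Or.inr (mem_iUnion₂.2 ⟨e, he.trans hij, hxe⟩)
  · obtain ⟨e, ⟨-, he⟩, hxe⟩ := mem_iUnion₂.1 hxj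
    by_cases hb : Γ.level (Γ.bot e) ≤ i
    · exact hxi (mem_iUnion₂.2 ⟨e, ⟨hb, hij.trans_lt he⟩, hxe⟩)
    · obtain ⟨p, -, rfl⟩ := D.openAnnulus_subset_range e hxe
      rcases hx' with ⟨v, hv, hxv⟩ | ⟨e', he', hxe'⟩
      · rcases (D.collar_mem_piece_iff e p v).1 hxv with ⟨rfl, -⟩ | ⟨rfl, -⟩
        · exact hb hv
        · exact not_lt.2 (hv.trans hij) he
      · refine D.collar_notMem_range ?_ p
          (D.openAnnulus_subset_range e' (D.vanishingCycle_subset_openAnnulus e' hxe'))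
        rintro rfl
        exact not_lt.2 (he'.trans hij) he

theorem W_mono {i j : ℤ} (hij : i ≤ j) : D.W i ≤ D.W j := by
  rintro _ ⟨m, rfl⟩
  exact ⟨SingH.inclMap D.zeros (sdiff_subset_sdiff_left (D.surfaceLE_mono hij)) m,
    SingH.inclMap_inclMap D.zeros _ (fun _ hx => hx.2) m⟩

theorem W_eq_bot {i : ℤ} (hi : i < -(Γ.depth : ℤ)) : D.W i = ⊥ := by
  have hY : D.surfaceLE i \ D.poles = ∅ := by
    refine eq_empty_of_forall_notMem ?_
    rintro x ⟨⟨hx, -⟩, -⟩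
    have hx' : (∃ v, Γ.level v ≤ i ∧ x ∈ D.piece v) ∨
        ∃ e, Γ.level (Γ.top e) ≤ i ∧ x ∈ D.vanishingCycle e := by
      simpa using hx
    rcases hx' with ⟨v, hv, -⟩ | ⟨e, he, -⟩
    · have := (Γ.level_mem v).1
      omega
    · have := (Γ.level_mem (Γ.top e)).1
      omega
  rw [eq_bot_iff]
  rintro _ ⟨m, rfl⟩
  obtain ⟨⟨c, hc⟩, rfl⟩ := Submodule.Quotient.mk_surjective _ m
  have : c = 0 := by
    rw [Finsupp.ext_iff]
    intro σ
    by_contra hσ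
    have := hc.1 (Finsupp.mem_support_iff.2 hσ) (mem_range_self (stdSimplex.vertex 0))
    rw [hY] at this
    exact this
  subst this
  exact Submodule.zero_mem _

theorem W_eq_top {i : ℤ} (hi : 0 ≤ i) : D.W i = ⊤ := by
  have hY : D.polesᶜ ⊆ D.surfaceLE i \ D.poles := by
    intro x hx
    refine ⟨⟨?_, fun h => ?_⟩, hx⟩
    · rcases D.mem_piece_or_vanishingCycle x with ⟨v, hv⟩ | ⟨e, he⟩
      · exact Or.inl (mem_iUnion₂.2 ⟨v, (Γ.level_mem v).2.trans hi, hv⟩)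
      · exact Or.inr (mem_iUnion₂.2 ⟨e, (Γ.level_mem _).2.trans hi, he⟩)
    · obtain ⟨e, ⟨-, he⟩, -⟩ := mem_iUnion₂.1 h
      have := (Γ.level_mem (Γ.top e)).2
      omega
  rw [eq_top_iff]
  rintro m -
  exact ⟨SingH.inclMap D.zeros hY m, (SingH.inclMap_inclMap D.zeros hY (fun _ hx => hx.2) m).trans
    (SingH.inclMap_refl D.zeros Subset.rfl m)⟩

theorem surfaceLE_disjoint_openAnnulus {i : ℤ} {e : E} (he : i < Γ.level (Γ.bot e)) :
    Disjoint (D.surfaceLE i) (D.openAnnulus e) := by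
  have he' := he.trans_le (Γ.level_bot_le e)
  rw [Set.disjoint_left]
  rintro x ⟨hx, -⟩ hxe
  have hx' : (∃ v, Γ.level v ≤ i ∧ x ∈ D.piece v) ∨
      ∃ e, Γ.level (Γ.top e) ≤ i ∧ x ∈ D.vanishingCycle e := by
    simpa using hx
  obtain ⟨p, -, rfl⟩ := D.openAnnulus_subset_range e hxe
  rcases hx' with ⟨v, hv, hxv⟩ | ⟨e', hv, hxe'⟩
  · rcases (D.collar_mem_piece_iff e p v).1 hxv with ⟨rfl, -⟩ | ⟨rfl, -⟩
    · exact not_lt.2 hv he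
    · exact not_lt.2 hv he'
  · refine D.collar_notMem_range ?_ p
      (D.openAnnulus_subset_range e' (D.vanishingCycle_subset_openAnnulus e' hxe'))
    rintro rfl
    exact not_lt.2 hv he'

/-- The class has a representative in the subsurface of level at most `i`, on which the collapse map
is constant. For horizontal edges this yields `W i ≤ U j` whenever `i < j`. -/
theorem inter_eq_zero_of_mem_W [T2Space S] {i : ℤ} {e : E} (he : i < Γ.level (Γ.bot e))
    {c : D.RelH1} (hc : c ∈ D.W i) : D.inter e c = 0 := by
  obtain ⟨m, rfl⟩ := hc
  obtain ⟨⟨c, hc⟩, rfl⟩ := Submodule.Quotient.mk_surjective _ m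
  refine SingH.chainWinding_eq_zero _ (A := D.surfaceLE i \ D.poles) (fun a ha => ?_) hc.1
  exact D.collapseFun_of_notMem e (Set.disjoint_left.1 (D.surfaceLE_disjoint_openAnnulus he) ha.1)

theorem mem_U_iff [T2Space S] {i : ℤ} {c : D.RelH1} :
    c ∈ D.U i ↔ c ∈ D.W i ∧ ∀ e : Γ.HorEdge i, D.inter e.1 c = 0 := by
  simp [U, Submodule.mem_iInf]

theorem U_le_W [T2Space S] (i : ℤ) : D.U i ≤ D.W i := inf_le_left

theorem W_le_U [T2Space S] {i j : ℤ} (hij : i < j) : D.W i ≤ D.U j := by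
  intro c hc
  refine D.mem_U_iff.2 ⟨D.W_mono hij.le hc, fun e => D.inter_eq_zero_of_mem_W ?_ hc⟩
  rw [show Γ.level (Γ.bot e.1) = j from e.2.1.trans e.2.2]
  exact hij

/-! ### Dual systems of the horizontal vanishing cycles -/

section Dual

variable [T2Space S] {i : ℤ} {δ : Γ.HorEdge i → D.RelH1}

theorem inter_sum_smul [Fintype (Γ.HorEdge i)] (hδ : ∀ e, D.inter e.1 (δ e) = 1)
    (hδ' : ∀ e e' : Γ.HorEdge i, e' ≠ e → D.inter e'.1 (δ e) = 0) (a : Γ.HorEdge i → ℂ)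
    (e : Γ.HorEdge i) : D.inter e.1 (∑ e', a e' • δ e') = a e := by
  rw [map_sum, Finset.sum_eq_single e]
  · simp [hδ]
  · intro e' _ hne
    rw [map_smul, hδ' e' e hne.symm, smul_zero]
  · simp

theorem linearIndependent_of_dual (hδ : ∀ e, D.inter e.1 (δ e) = 1)
    (hδ' : ∀ e e' : Γ.HorEdge i, e' ≠ e → D.inter e'.1 (δ e) = 0) : LinearIndependent ℂ δ := by
  have := Fintype.ofFinite (Γ.HorEdge i)
  rw [Fintype.linearIndependent_iff]
  intro a ha e
  rw [← D.inter_sum_smul hδ hδ' a e, ha, map_zero]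

theorem disjoint_span_U_of_dual (hδ : ∀ e, D.inter e.1 (δ e) = 1)
    (hδ' : ∀ e e' : Γ.HorEdge i, e' ≠ e → D.inter e'.1 (δ e) = 0) :
    Disjoint (Submodule.span ℂ (range δ)) (D.U i) := by
  have := Fintype.ofFinite (Γ.HorEdge i)
  rw [Submodule.disjoint_def]
  intro c hc hcU
  obtain ⟨a, rfl⟩ := (Submodule.mem_span_range_iff_exists_fun ℂ).1 hc
  refine Finset.sum_eq_zero fun e _ => ?_
  rw [← D.inter_sum_smul hδ hδ' a e, (D.mem_U_iff.1 hcU).2 e, zero_smul]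

/-- Subtracting `∑ ⟨c, λ_e⟩ δ_e` from `c ∈ W i` removes all its horizontal intersection numbers of
level `i`. -/
theorem span_sup_U_of_dual (hW : ∀ e, δ e ∈ D.W i) (hδ : ∀ e, D.inter e.1 (δ e) = 1)
    (hδ' : ∀ e e' : Γ.HorEdge i, e' ≠ e → D.inter e'.1 (δ e) = 0) :
    Submodule.span ℂ (range δ) ⊔ D.U i = D.W i := by
  have := Fintype.ofFinite (Γ.HorEdge i)
  refine le_antisymm (sup_le (Submodule.span_le.2 ?_) (D.U_le_W i)) fun c hc => ?_
  · rintro _ ⟨e, rfl⟩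
    exact hW e
  · have hs : ∑ e, D.inter e.1 c • δ e ∈ Submodule.span ℂ (range δ) :=
      Submodule.sum_mem _ fun e _ => Submodule.smul_mem _ _ (Submodule.subset_span ⟨e, rfl⟩)
    refine Submodule.mem_sup.2 ⟨_, hs, c - ∑ e, D.inter e.1 c • δ e, ?_, add_sub_cancel _ _⟩
    refine D.mem_U_iff.2 ⟨Submodule.sub_mem _ hc (Submodule.sum_mem _ fun e _ =>
      Submodule.smul_mem _ _ (hW e)), fun e => ?_⟩
    rw [map_sub, D.inter_sum_smul hδ hδ', sub_self]

end Dual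

end PinchedSurface

/-! ### Assembly of the adapted basis. -/

theorem proposition4p3 {V E H : Type*} [Fintype V] [Fintype E] [Fintype H]
    (Γ : EnhancedLevelGraph V E H)
    {S : Type*} [TopologicalSpace S] [T2Space S] [CompactSpace S] [ConnectedSpace S]
    [ChartedSpace ℂ S] [IsManifold (modelWithCornersSelf ℂ ℂ) 1 S]
    (D : PinchedSurface Γ S) :
    ∃ (n : Γ.Levels → ℕ)
      (b : Module.Basis (Σ i : Γ.Levels, Fin (n i) ⊕ Γ.HorEdge i) ℂ D.RelH1),
      D.IsAdapted b := by
  have hfd := D.finiteDimensional_relH1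
  have hδ : ∀ i : Γ.Levels, ∀ e : Γ.HorEdge i, ∃ c ∈ D.W i, D.inter e.1 c = 1 ∧
      ∀ e', Γ.IsHorizontal e' → e' ≠ e.1 → D.inter e' c = 0 := fun i e => D.exists_crossing_cycle e
  choose δ hδW hδ1 hδ0 using hδ
  have hδ0' : ∀ (i : Γ.Levels) (e e' : Γ.HorEdge i), e' ≠ e → D.inter e'.1 (δ i e) = 0 :=
    fun i e e' h => hδ0 i e e'.1 e'.2.1 fun h' => h (Subtype.ext h')
  have hDU : ∀ i : Γ.Levels, Disjoint (Submodule.span ℂ (range (δ i))) (D.U i) := fun i =>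
    D.disjoint_span_U_of_dual (hδ1 i) (hδ0' i)
  have hDW : ∀ i : Γ.Levels, Submodule.span ℂ (range (δ i)) ⊔ D.U i = D.W i := fun i =>
    D.span_sup_U_of_dual (hδW i) (hδ1 i) (hδ0' i)
  obtain ⟨n, b, hbδ, hbdis, hbsup, hbspan⟩ := PinchedSurface.exists_graded_basis
    (M := D.RelH1) (N := Γ.depth) (W := D.W) (U := D.U) (κ := fun i => Γ.HorEdge i)
    (fun i hi => D.W_eq_bot hi) (fun i hi => D.W_eq_top hi) (fun i => D.W_le_U (by omega)) δ
    (fun i => D.linearIndependent_of_dual (hδ1 i) (hδ0' i)) hDU hDW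
  have hδU : ∀ (i : Γ.Levels) (e : Γ.HorEdge i), δ i e ∉ D.U i := by
    intro i e h
    have := (D.mem_U_iff.1 h).2 e
    rw [hδ1] at this
    exact one_ne_zero this
  have hmem : ∀ (i : Γ.Levels) k, b ⟨i, Sum.inl k⟩ ∈
      Submodule.span ℂ (range fun k => b ⟨i, Sum.inl k⟩) :=
    fun i k => Submodule.subset_span ⟨k, rfl⟩
  have hbU : ∀ (i : Γ.Levels) k, b ⟨i, Sum.inl k⟩ ∈ D.U i := fun i k =>
    hbsup i ▸ Submodule.mem_sup_left (hmem i k)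
  have hbW : ∀ (i : Γ.Levels) k, b ⟨i, Sum.inl k⟩ ∉ D.W (i - 1) := fun i k h =>
    b.ne_zero _ (Submodule.disjoint_def.1 (hbdis i) _ (hmem i k) h)
  refine ⟨n, b, ?_, ?_, ?_, ?_, hbspan, ?_, ?_, ?_, ?_⟩
  · intro i e
    rw [hbδ]
    exact ⟨hδW i e, hδU i e⟩
  · intro i e
    rw [hbδ]
    -- The top level is exactly `i`, because `W (i - 1) ≤ U i` and the cycle is not in `U i`.
    refine ⟨i, ⟨hδW i e, fun h => hδU i e (D.W_le_U (show (i : ℤ) - 1 < i by omega) h)⟩, e, ?_⟩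
    rw [hδ1]
    exact one_ne_zero
  · exact fun i k => ⟨hbU i k, hbW i k⟩
  · rintro i k ⟨j, ⟨hj, hj'⟩, e, he⟩
    -- The top level is unique because `W` is monotone, and at level `i` the cycle lies in `U i`.
    have h1 : j = i := by
      rcases lt_trichotomy j (i : ℤ) with h | h | h
      · exact absurd (D.W_mono (show j ≤ (i : ℤ) - 1 by omega) hj) (hbW i k)
      · exact h
      · exact absurd (D.W_mono (show (i : ℤ) ≤ j - 1 by omega) (D.U_le_W _ (hbU i k))) hj'
    subst h1
    exact he ((D.mem_U_iff.1 (hbU i k)).2 e)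
  · intro i
    simp only [hbδ]
    exact PinchedSurface.mapsIsoOnto_of_disjoint (hDU i) (hDW i)
  · exact fun i => PinchedSurface.mapsIsoOnto_of_disjoint (hbdis i) (hbsup i)
  · intro i e
    rw [hbδ, hδ1]
  · intro i e e' he' hne
    rw [hbδ]
    exact hδ0 i e e' he' hne
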